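/- **Setting.** Fix $M>0$ (energy drawn per relay transmission), $\lambda_1>0$, source power $P_S>0$, noise level $\sigma>0$, source–destination distance $d_{SD}>0$, path-loss exponent $\alpha\in\mathbb R$, and an SNR threshold $\Gamma'_{th}\in[0,\infty]$ ($\Gamma'_{th}=2^{2R_0}-1$ for incremental signalling at rate $R_0$, $\Gamma'_{th}=\infty$ for non-incremental signalling). For $i=0,1,2,\dots$ let $X(i)$ be the harvested energy, exponentially distributed with rate $\lambda_1$ (CDF $F_X(x)=1-e^{-\lambda_1x}$ for $x\ge0$), and let $h_{SD}(i)\sim\mathcal{CN}(0,d_{SD}^{-\alpha})$ be the source–destination channel, with SNR $\gamma_{SD}(i)=P_S|h_{SD}(i)|^2/\sigma^2$. Assume that $X(i)$ and $h_{SD}(i)$ are independent for each $i$, that the pairs $(X(i),h_{SD}(i))$ are independent over $i$, and that the sequence of pairs is independent of the initial energy $B(0)\ge 0$, whose distribution is arbitrary. The energy $B(i)$ in the infinite-size primary energy buffer evolves by the incremental on-off policy $$B(i+1)=\begin{cases}B(i)+X(i), & \gamma_{SD}(i)\ge\Gamma'_{th},\\ B(i)-M+X(i), & \gamma_{SD}(i)<\Gamma'_{th},\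 B(i)\ge M,\\ B(i)+X(i), & \gamma_{SD}(i)<\Gamma'_{th},\ B(i)<M.\end{cases}$$ Put $W_2=\sigma^2d_{SD}^{\alpha}/P_S$ (with $e^{-W_2\Gamma'_{th}}=0$ if $\Gamma'_{th}=\infty$), $\phi_{inc}=M\lambda_1(1-e^{-W_2\Gamma'_{th}})$ and $$Q=-\frac{\mathcal W\left(-(1-e^{-W_2\Gamma'_{th}})\lambda_1M\,e^{-(1-e^{-W_2\Gamma'_{th}})\lambda_1M}\right)}{M}-(1-e^{-W_2\Gamma'_{th}})\lambda_1,$$ where $\mathcal W$ is the principal branch of the Lambert W function. **Theorem.** Suppose $\phi_{inc}>1$. Then $Q<0$, and the buffer has a limiting distribution: $B(i)$ converges in distribution, as $i\to\infty$, to a probability law on $\mathbb R$ that has the PDF $$g(x)=\begin{cases}0, & x<0,\\[2pt] \dfrac{1-e^{Qx}}{M}, & 0\le x<M,\\[6pt] \dfrac{-Qe^{Qx}}{M\left(Q+\lambda_1(1-e^{-W_2\Gamma'_{th}})\right)}, & x\ge M,\end{cases}$$ and whose CDF $G$ satisfies the integral equation $$G(x)=e^{-W_2\Gamma'_{th}}\int_0^xF_X(x-u)g(u)\,du+(1-e^{-W_2\Gamma'_{th}})\left[\int_M^{M+x}F_X(x-u+M)g(u)\,du+\int_0^{\min(x,M)}F_X(x-u)g(u)\,du\right],\qquad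 x\ge0$$ (the last integral runs over $[0,x]$ if $0\le x<M$ and over $[0,M]$ if $x\ge M$). -/

import Mathlib

open MeasureTheory ProbabilityTheory Filter Topology
open scoped ENNReal NNReal

namespace IOFP

noncomputable section

/-- The principal branch of the Lambert W function on the reals: for `x ≥ -1/e` it is the unique
`w ≥ -1` with `w * exp w = x`. -/
def lambertW (x : ℝ) : ℝ :=
  Function.invFunOn (fun w : ℝ => w * Real.exp w) (Set.Ici (-1)) x

/-- The circularly symmetric complex Gaussian law `CN(0, v)`: the real and imaginary parts are
independent centred real Gaussians of variance `v / 2`. -/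
def complexGaussian (v : ℝ≥0) : Measure ℂ :=
  ((gaussianReal 0 (v / 2)).prod (gaussianReal 0 (v / 2))).map
    (fun p : ℝ × ℝ => (⟨p.1, p.2⟩ : ℂ))

/-- The instantaneous link SNR `P |h|² / σ²`. -/
def linkSNR (P σ : ℝ) (h : ℂ) : ℝ := P * ‖h‖ ^ 2 / σ ^ 2

/-- The constant `W₂ = σ² d ^ α / P`. -/
def W2 (P σ d α : ℝ) : ℝ := σ ^ 2 * d ^ α / P

/-- The number `exp (-w Γ)` for a threshold `Γ ∈ [0, ∞]` and `w > 0`; it is `0` when `Γ = ∞`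
(non-incremental signalling). -/
def expNeg (w : ℝ) (Γ : ℝ≥0∞) : ℝ :=
  if Γ = ⊤ then 0 else Real.exp (-(w * Γ.toReal))

/-- The constant `φ_inc = M λ₁ (1 - exp (-W₂ Γ))`. -/
def phiInc (M lam w : ℝ) (Γ : ℝ≥0∞) : ℝ := M * lam * (1 - expNeg w Γ)

/-- One step of the buffer under the incremental on-off policy: `b` is the stored energy, `x` the
harvested energy and `γ` the SNR of the direct link. -/
def bufferStep (M : ℝ) (Γ : ℝ≥0∞) (b x γ : ℝ) : ℝ :=
  if Γ ≤ ENNReal.ofReal γ then b + x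
  else if M ≤ b then b - M + x
  else b + x

/-- The exponent `Q`. -/
def Q (M lam w : ℝ) (Γ : ℝ≥0∞) : ℝ :=
  -(lambertW (-((1 - expNeg w Γ) * lam * M) * Real.exp (-((1 - expNeg w Γ) * lam * M))) / M)
    - (1 - expNeg w Γ) * lam

/-- The limiting density; the stored energy is nonnegative, so it vanishes on `x < 0`. -/
def limitPDF (M lam w : ℝ) (Γ : ℝ≥0∞) (x : ℝ) : ℝ :=
  if x < 0 then 0
  else if x < M then (1 - Real.exp (Q M lam w Γ * x)) / M
  else -Q M lam w Γ * Real.exp (Q M lam w Γ * x)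
    / (M * (Q M lam w Γ + lam * (1 - expNeg w Γ)))

/-- The piecewise integral equation relating a distribution function `G`, its density `g` and the
distribution function `F` of the harvested energy; `w = W₂`. -/
def IntegralEquation (M w : ℝ) (Γ : ℝ≥0∞) (F G g : ℝ → ℝ) : Prop :=
  (∀ x : ℝ, 0 ≤ x → x < M →
    G x = expNeg w Γ * (∫ u in (0 : ℝ)..x, F (x - u) * g u)
      + (1 - expNeg w Γ) * ((∫ u in M..(M + x), F (x - u + M) * g u)
        + ∫ u in (0 : ℝ)..x, F (x - u) * g u)) ∧
  (∀ x : ℝ, M ≤ x →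
    G x = expNeg w Γ * (∫ u in (0 : ℝ)..x, F (x - u) * g u)
      + (1 - expNeg w Γ) * ((∫ u in M..(M + x), F (x - u + M) * g u)
        + ∫ u in (0 : ℝ)..M, F (x - u) * g u))

end

end IOFP

namespace IOFP

/-! ### Harris' ergodic theorem for chains driven by i.i.d. noise. -/

section Harris

/-! The pairs (harvested energy, channel) are i.i.d. and independent of the initial energy, so the
buffer is a Markov chain. Under Rayleigh fading |h|² is exponential, so the direct link fails with
probability p = 1 - e^{-W₂Γ}. From energy b the chain moves to b + X with probability 1 - p and to
`drained M b` + X with probability p.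

Above M the mean drift is 1/λ - pM, negative exactly when φ_inc = pλM > 1. For small θ > 0 the
function e^{θb} therefore satisfies a geometric drift inequality (`exists_drift_exponent`,
`lyapunov_drift`). On its sublevel sets the exponential harvest supplies a common component of all
transition laws (`stepMap_minorization`). Harris' theorem then gives convergence to any invariant
probability law from every initial law, so it remains only to exhibit one.

Invariance of a density g means g(x) = ∫ λe^{-λ(x-u)} T(u) du, with T the density of the energy left
before harvesting; equivalently g' = λ(T - g) with g(0) = 0. For x > M this is g' = λp(g(x+M) -
g(x)), solved by e^{Qx} when Q = λp(e^{QM} - 1). With W = -QM - φ this reads We^W = -φe^{-φ}. The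
trivial root W = -φ is below -1 when φ > 1, so the principal branch is the other root, and Q < 0
(`Q_spec`). Integration by parts turns the differential equation into the stated integral equation
(`integral_bufferDensity_eq`), which is also the invariance of the law (`map_stepMap_bufferLaw`). -/

lemma exists_center {S : Type*} [Nonempty S] {f w : S → ℝ} (h : ∀ x y, |f x - f y| ≤ w x + w y) :
    ∃ c, ∀ x, |f x - c| ≤ w x := by
  obtain ⟨x₀⟩ := ‹Nonempty S›
  have hb : BddAbove (Set.range fun x => f x - w x) := by
    refine ⟨f x₀ + w x₀, ?_⟩
    rintro _ ⟨x, rfl⟩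
    have := (abs_le.1 (h x x₀)).2
    simp only
    linarith
  -- The intervals [f x - w x, f x + w x] meet pairwise, hence share a point: the supremum of their
  -- left ends.
  refine ⟨⨆ x, (f x - w x), fun x => ?_⟩
  have h1 := le_ciSup hb x
  have h2 : ⨆ x, (f x - w x) ≤ f x + w x := by
    have : Nonempty S := ⟨x⟩
    refine ciSup_le fun y => ?_
    have := (abs_le.1 (h y x)).2
    linarith
  rw [abs_le]
  constructor <;> linarith

variable {S E : Type*} [MeasurableSpace S] [MeasurableSpace E]

/-- The transition operator of the Markov chain `x ↦ g (x, e)` with `e` distributed as `ρ`. -/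
noncomputable def transOp (g : S × E → S) (ρ : Measure E) (f : S → ℝ) (x : S) : ℝ :=
  ∫ s, f s ∂(ρ.map fun e => g (x, e))

variable {g : S × E → S} {ρ : Measure E}

lemma transOp_eq (hg : Measurable g) {f : S → ℝ} (hf : Measurable f) (x : S) :
    transOp g ρ f x = ∫ e, f (g (x, e)) ∂ρ :=
  integral_map (hg.comp measurable_prodMk_left).aemeasurable hf.aestronglyMeasurable

variable [IsProbabilityMeasure ρ]

lemma isProbabilityMeasure_transition (hg : Measurable g) (x : S) :
    IsProbabilityMeasure (ρ.map fun e => g (x, e)) :=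
  Measure.isProbabilityMeasure_map (hg.comp measurable_prodMk_left).aemeasurable

lemma measurable_transOp (hg : Measurable g) {f : S → ℝ} (hf : Measurable f) :
    Measurable (transOp g ρ f) := by
  have : transOp g ρ f = fun x => ∫ e, f (g (x, e)) ∂ρ := funext (transOp_eq hg hf)
  rw [this]
  have h := StronglyMeasurable.integral_prod_right (ν := ρ) (f := fun x e => f (g (x, e)))
    (hf.comp hg).stronglyMeasurable
  exact h.measurable

lemma integrable_of_abs_le {m : Measure S} [IsFiniteMeasure m] {f : S → ℝ} (hf : Measurable f)
    {A : ℝ} (hA : ∀ s, |f s| ≤ A) : Integrable f m :=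
  Integrable.of_bound hf.aestronglyMeasurable A (ae_of_all _ hA)

lemma abs_transOp_le (hg : Measurable g) {f : S → ℝ} {A : ℝ} (hA : ∀ s, |f s| ≤ A) (x : S) :
    |transOp g ρ f x| ≤ A := by
  have := isProbabilityMeasure_transition (ρ := ρ) hg x
  have h := norm_integral_le_of_norm_le_const (μ := ρ.map fun e => g (x, e)) (f := f) (C := A)
    (ae_of_all _ hA)
  simpa [transOp] using h

lemma measurable_iterate_transOp (hg : Measurable g) {f : S → ℝ} (hf : Measurable f) (n : ℕ) :
    Measurable ((transOp g ρ)^[n] f) := by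
  induction n with
  | zero => exact hf
  | succ n ih => rw [Function.iterate_succ_apply']; exact measurable_transOp hg ih

lemma abs_iterate_transOp_le (hg : Measurable g) {f : S → ℝ} {A : ℝ} (hA : ∀ s, |f s| ≤ A)
    (n : ℕ) : ∀ x, |(transOp g ρ)^[n] f x| ≤ A := by
  induction n with
  | zero => exact hA
  | succ n ih => rw [Function.iterate_succ_apply']; exact abs_transOp_le hg ih

lemma integral_map_prod_eq_transOp (hg : Measurable g) (m : Measure S) [IsProbabilityMeasure m]
    {f : S → ℝ} (hf : Measurable f) {A : ℝ} (hA : ∀ s, |f s| ≤ A) :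
    ∫ s, f s ∂((m.prod ρ).map g) = ∫ s, transOp g ρ f s ∂m := by
  rw [integral_map hg.aemeasurable hf.aestronglyMeasurable, integral_prod]
  · exact integral_congr_ae (ae_of_all _ fun x => (transOp_eq hg hf x).symm)
  · exact integrable_of_abs_le (hf.comp hg) fun s => hA _

/-- Duality: evolving the law is the same as iterating the operator on the test function, so only
the iterates need be studied, against a fixed initial law. -/
lemma integral_iterate_transOp (hg : Measurable g) {m : ℕ → Measure S}
    (hm : ∀ n, IsProbabilityMeasure (m n)) (hstep : ∀ n, m (n + 1) = ((m n).prod ρ).map g)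
    {A : ℝ} (n : ℕ) : ∀ {f : S → ℝ}, Measurable f → (∀ s, |f s| ≤ A) →
      ∫ s, f s ∂(m n) = ∫ s, (transOp g ρ)^[n] f s ∂(m 0) := by
  induction n with
  | zero => intro f _ _; rfl
  | succ n ih =>
    intro f hf hA
    rw [hstep, integral_map_prod_eq_transOp hg (m n) hf hA,
      ih (measurable_transOp hg hf) (abs_transOp_le hg hA), Function.iterate_succ_apply]

/-- This is |∫ f| ≤ ∫ φ for the positive measure κ - η, written without subtracting measures; it
follows by comparing η and κ on the nonnegative functions φ - f and φ + f. -/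
lemma abs_integral_sub_integral_le {κ η : Measure S} (h : η ≤ κ) {f φ : S → ℝ}
    (hf : Integrable f κ) (hφ : Integrable φ κ) (hle : ∀ s, |f s| ≤ φ s) :
    |(∫ s, f s ∂κ) - ∫ s, f s ∂η| ≤ (∫ s, φ s ∂κ) - ∫ s, φ s ∂η := by
  have h1 := integral_mono_measure h (ae_of_all _ fun s => sub_nonneg.2 (abs_le.1 (hle s)).2)
    (hφ.sub hf)
  have h2 := integral_mono_measure (f := fun s => φ s + f s) h
    (ae_of_all _ fun s => by have := (abs_le.1 (hle s)).1; simp only [Pi.zero_apply]; linarith)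
    (hφ.add hf)
  rw [integral_sub (hφ.mono_measure h) (hf.mono_measure h), integral_sub hφ hf] at h1
  rw [integral_add (hφ.mono_measure h) (hf.mono_measure h), integral_add hφ hf] at h2
  rw [abs_le]
  constructor <;> linarith

/-- The one-step contraction in Harris' theorem, in the form of Hairer and Mattingly. -/
lemma exists_transOp_contraction [Nonempty S] (hg : Measurable g) {V : S → ℝ}
    (hV0 : ∀ x, 0 ≤ V x)
    (hVint : ∀ x, Integrable V (ρ.map fun e => g (x, e)))
    {γ D : ℝ} (hγ0 : 0 ≤ γ) (hγ1 : γ < 1) (hD : 0 ≤ D)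
    (hdrift : ∀ x, transOp g ρ V x ≤ γ * V x + D)
    (hminor : ∀ R : ℝ, ∃ η : Measure S, η ≠ 0 ∧
      ∀ x, V x ≤ R → η ≤ ρ.map fun e => g (x, e)) :
    ∃ a β : ℝ, 0 ≤ a ∧ a < 1 ∧ 0 < β ∧ ∀ (f : S → ℝ) (A L : ℝ), Measurable f → (∀ s, |f s| ≤ L) →
      0 ≤ A → (∃ c, ∀ x, |f x - c| ≤ A * (1 + β * V x)) →
      ∃ c, ∀ x, |transOp g ρ f x - c| ≤ a * A * (1 + β * V x) := by
  -- Once V x + V y ≥ R, half of the drift gain (1 - γ)(V x + V y) pays for the additive 2D.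
  set R : ℝ := 4 * (D + 1) / (1 - γ) with hR
  have hγ' : 0 < 1 - γ := by linarith
  have hRpos : 0 < R := by positivity
  have hRmul : R * (1 - γ) = 4 * (D + 1) := by rw [hR]; field_simp
  obtain ⟨x₀⟩ := ‹Nonempty S›
  have : Nonempty S := ⟨x₀⟩
  -- The level is raised to V x₀ so that the sublevel set is nonempty; this forces η to have mass at
  -- most 1.
  obtain ⟨η, hη0, hη⟩ := hminor (max R (V x₀))
  have hne : ∃ x, V x ≤ max R (V x₀) := ⟨x₀, le_max_right _ _⟩
  have hηfin : IsFiniteMeasure η := by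
    obtain ⟨x, hx⟩ := hne
    have := isProbabilityMeasure_transition (ρ := ρ) hg x
    exact isFiniteMeasure_of_le _ (hη x hx)
  set ε : ℝ := η.real Set.univ with hε
  have hεpos : 0 < ε := by
    rw [hε, measureReal_def]
    exact ENNReal.toReal_pos (by simpa using hη0) (measure_ne_top _ _)
  have hε1 : ε ≤ 1 := by
    obtain ⟨x, hx⟩ := hne
    have := isProbabilityMeasure_transition (ρ := ρ) hg x
    have h1 := hη x hx Set.univ
    rw [measure_univ (μ := ρ.map fun e => g (x, e))] at h1
    rw [hε, measureReal_def]
    exact ENNReal.toReal_le_of_le_ofReal zero_le_one (by simpa using h1)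
  -- With this weight 2βD ≤ ε, so the gain 2ε from minorization at two points leaves ε to spare.
  set β : ℝ := ε / (2 * (D + 1)) with hβ
  have hβpos : 0 < β := by positivity
  have hβD : β * (D + 1) = ε / 2 := by rw [hβ]; field_simp
  -- The remaining drift gain relative to the weight 2 + βs increases with s = V x + V y; τ is its
  -- value at s = R.
  set τ : ℝ := β * R * ((1 - γ) / 2) / (2 + β * R) with hτ
  have hτmul : τ * (2 + β * R) = β * R * ((1 - γ) / 2) := by rw [hτ]; field_simp
  have hτpos : 0 < τ := by positivity
  have hτle : τ ≤ (1 - γ) / 2 := by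
    rw [hτ, div_le_iff₀ (by positivity)]
    nlinarith
  set δ : ℝ := min (ε / 2) τ with hδ
  have hδpos : 0 < δ := lt_min (by positivity) hτpos
  have hδε : δ ≤ ε / 2 := min_le_left _ _
  have hδτ : δ ≤ τ := min_le_right _ _
  refine ⟨1 - δ, β, by linarith, by linarith, hβpos, ?_⟩
  intro f A L hf hL hA ⟨c, hc⟩
  have key1 : ∀ x, |transOp g ρ f x - c| ≤ A * (1 + β * (γ * V x + D)) := by
    intro x
    have := isProbabilityMeasure_transition (ρ := ρ) hg x
    have hfi := integrable_of_abs_le (m := ρ.map fun e => g (x, e)) hf hL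
    have h1 : transOp g ρ f x - c = ∫ s, (f s - c) ∂(ρ.map fun e => g (x, e)) := by
      rw [integral_sub hfi (integrable_const c)]; simp [transOp]
    have h2 : ∫ s, A * (1 + β * V s) ∂(ρ.map fun e => g (x, e))
        = A * (1 + β * transOp g ρ V x) := by
      rw [integral_const_mul, integral_add (integrable_const _) ((hVint x).const_mul _),
        integral_const_mul]
      simp [transOp]
    calc |transOp g ρ f x - c|
        ≤ ∫ s, |f s - c| ∂(ρ.map fun e => g (x, e)) := by rw [h1]; exact abs_integral_le_integral_abs
      _ ≤ ∫ s, A * (1 + β * V s) ∂(ρ.map fun e => g (x, e)) :=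
          integral_mono (hfi.sub (integrable_const c)).abs
            (((integrable_const _).add ((hVint x).const_mul _)).const_mul _) hc
      _ ≤ _ := by
          rw [h2]
          have := hdrift x
          gcongr
  -- Integrating f - c against the transition law minus η saves the mass ε; the price is a new
  -- centre, which does not depend on x.
  have key2 : ∀ x, V x ≤ max R (V x₀) → |transOp g ρ f x - (c * (1 - ε) + ∫ s, f s ∂η)|
      ≤ A * (1 + β * (γ * V x + D) - ε) := by
    intro x hx
    have := isProbabilityMeasure_transition (ρ := ρ) hg x
    have hle := hη x hx
    have hfi := integrable_of_abs_le (m := ρ.map fun e => g (x, e)) hf hL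
    have h1 := abs_integral_sub_integral_le hle (f := fun s => f s - c)
      (φ := fun s => A * (1 + β * V s)) (hfi.sub (integrable_const c))
      (((integrable_const _).add ((hVint x).const_mul _)).const_mul _) hc
    have h2 : ∫ s, A * (1 + β * V s) ∂(ρ.map fun e => g (x, e))
        = A * (1 + β * transOp g ρ V x) := by
      rw [integral_const_mul, integral_add (integrable_const _) ((hVint x).const_mul _),
        integral_const_mul]
      simp [transOp]
    have h3 : A * ε ≤ ∫ s, A * (1 + β * V s) ∂η := by
      rw [integral_const_mul, integral_add (integrable_const _)
        (((hVint x).mono_measure hle).const_mul _), integral_const_mul]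
      have h4 : 0 ≤ ∫ s, V s ∂η := integral_nonneg hV0
      have h5 : ∫ _, (1 : ℝ) ∂η = ε := by simp [hε]
      rw [h5]
      have : 0 ≤ β * ∫ s, V s ∂η := by positivity
      gcongr
      linarith
    rw [h2, integral_sub hfi (integrable_const c),
      integral_sub (hfi.mono_measure hle) (integrable_const c)] at h1
    have h6 : A * (1 + β * transOp g ρ V x) ≤ A * (1 + β * (γ * V x + D)) := by
      have := hdrift x
      gcongr
    have h7 : transOp g ρ f x - (c * (1 - ε) + ∫ s, f s ∂η)
      = ∫ s, f s ∂(ρ.map fun e => g (x, e)) - ∫ s, c ∂(ρ.map fun e => g (x, e))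
        - (∫ s, f s ∂η - ∫ s, c ∂η) := by
      simp [transOp, ← hε]; ring
    rw [h7]
    linarith
  -- Only differences need be bounded: pairs with V x + V y ≥ R contract by drift, the others by the
  -- common component η.
  refine exists_center fun x y => ?_
  have hVx := hV0 x
  have hVy := hV0 y
  obtain hS | hS := le_or_gt R (V x + V y)
  · have hx := key1 x
    have hy := key1 y
    have htri := abs_sub_le (transOp g ρ f x) c (transOp g ρ f y)
    rw [abs_sub_comm c] at htri
    have hmain : 2 + β * γ * (V x + V y) + 2 * (β * D) ≤ (1 - δ) * (2 + β * (V x + V y)) := by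
      have e1 : 2 * (β * D) ≤ β * ((1 - γ) / 2) * (V x + V y) := by
        have : 2 * D ≤ (1 - γ) / 2 * (V x + V y) := by nlinarith
        nlinarith
      have e2 : δ * (2 + β * (V x + V y)) ≤ β * ((1 - γ) / 2) * (V x + V y) := by
        have e3 : δ * (2 + β * (V x + V y)) ≤ τ * (2 + β * (V x + V y)) := by gcongr
        have e4 : τ * β * (V x + V y - R) ≤ (1 - γ) / 2 * β * (V x + V y - R) := by
          have : 0 ≤ V x + V y - R := by linarith
          gcongr
        nlinarith
      linarith
    calc _ ≤ A * (1 + β * (γ * V x + D)) + A * (1 + β * (γ * V y + D)) := by linarith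
      _ = A * (2 + β * γ * (V x + V y) + 2 * (β * D)) := by ring
      _ ≤ A * ((1 - δ) * (2 + β * (V x + V y))) := mul_le_mul_of_nonneg_left hmain hA
      _ = _ := by ring
  · have hx := key2 x (le_max_of_le_left (by linarith))
    have hy := key2 y (le_max_of_le_left (by linarith))
    have htri := abs_sub_le (transOp g ρ f x) (c * (1 - ε) + ∫ s, f s ∂η) (transOp g ρ f y)
    rw [abs_sub_comm (c * (1 - ε) + ∫ s, f s ∂η)] at htri
    have hmain : 2 + β * γ * (V x + V y) + 2 * (β * D) - 2 * ε
        ≤ (1 - δ) * (2 + β * (V x + V y)) := by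
      have e1 : δ * (β * (V x + V y)) ≤ (1 - γ) * (β * (V x + V y)) := by
        have : 0 ≤ β * (V x + V y) := by positivity
        gcongr
        linarith
      nlinarith
    calc _ ≤ A * (1 + β * (γ * V x + D) - ε) + A * (1 + β * (γ * V y + D) - ε) := by linarith
      _ = A * (2 + β * γ * (V x + V y) + 2 * (β * D) - 2 * ε) := by ring
      _ ≤ A * ((1 - δ) * (2 + β * (V x + V y))) := mul_le_mul_of_nonneg_left hmain hA
      _ = _ := by ring

/-- **Harris' theorem**: under a geometric drift condition and a minorization condition on the
sublevel sets of the Lyapunov function, the laws of the chain converge to the invariant law. -/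
theorem tendsto_integral_of_drift_of_minorization [Nonempty S] (hg : Measurable g) {V : S → ℝ}
    (hV0 : ∀ x, 0 ≤ V x)
    (hVint : ∀ x, Integrable V (ρ.map fun e => g (x, e)))
    {γ D : ℝ} (hγ0 : 0 ≤ γ) (hγ1 : γ < 1) (hD : 0 ≤ D)
    (hdrift : ∀ x, transOp g ρ V x ≤ γ * V x + D)
    (hminor : ∀ R : ℝ, ∃ η : Measure S, η ≠ 0 ∧
      ∀ x, V x ≤ R → η ≤ ρ.map fun e => g (x, e))
    {m : ℕ → Measure S} (hm : ∀ n, IsProbabilityMeasure (m n))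
    (hstep : ∀ n, m (n + 1) = ((m n).prod ρ).map g)
    {π : Measure S} [IsProbabilityMeasure π] (hπ : (π.prod ρ).map g = π)
    {f : S → ℝ} (hf : Measurable f) {L : ℝ} (hL : ∀ s, |f s| ≤ L) :
    Tendsto (fun n => ∫ s, f s ∂(m n)) atTop (𝓝 (∫ s, f s ∂π)) := by
  obtain ⟨a, β, ha0, ha1, hβ, hcontr⟩ :=
    exists_transOp_contraction hg hV0 hVint hγ0 hγ1 hD hdrift hminor
  have hL0 : 0 ≤ L := (abs_nonneg _).trans (hL (Classical.arbitrary S))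
  -- The centre may vary with n, so this controls only differences of the iterates between two
  -- points.
  have hcenter : ∀ n, ∃ c, ∀ x, |(transOp g ρ)^[n] f x - c| ≤ a ^ n * L * (1 + β * V x) := by
    intro n
    induction n with
    | zero =>
      refine ⟨0, fun x => ?_⟩
      have := mul_nonneg hL0 (mul_nonneg hβ.le (hV0 x))
      have := hL x
      simp only [Function.iterate_zero, id_eq, sub_zero, pow_zero, one_mul]
      linarith
    | succ n ih =>
      obtain ⟨c, hc⟩ := hcontr _ (a ^ n * L) L (measurable_iterate_transOp hg hf n)
        (abs_iterate_transOp_le hg hL n) (by positivity) ih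
      refine ⟨c, fun x => ?_⟩
      rw [Function.iterate_succ_apply', pow_succ', mul_assoc a]
      exact hc x
  have hpt : ∀ x y, Tendsto (fun n => (transOp g ρ)^[n] f x - (transOp g ρ)^[n] f y) atTop
      (𝓝 0) := by
    intro x y
    have hlim : Tendsto (fun n => a ^ n * (L * (2 + β * (V x + V y)))) atTop (𝓝 0) := by
      simpa using (tendsto_pow_atTop_nhds_zero_of_lt_one ha0 ha1).mul_const
        (L * (2 + β * (V x + V y)))
    refine squeeze_zero_norm (fun n => ?_) hlim
    obtain ⟨c, hc⟩ := hcenter n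
    have htri := abs_sub_le ((transOp g ρ)^[n] f x) c ((transOp g ρ)^[n] f y)
    rw [abs_sub_comm c] at htri
    have hx := hc x
    have hy := hc y
    rw [Real.norm_eq_abs]
    calc _ ≤ a ^ n * L * (1 + β * V x) + a ^ n * L * (1 + β * V y) := by linarith
      _ = _ := by ring
  set y₀ := Classical.arbitrary S
  -- Dominated convergence uses only the bound on f, so no moment of V under the initial or
  -- invariant law is required.
  have hint : ∀ (ν : Measure S) [IsProbabilityMeasure ν],
      Tendsto (fun n => ∫ s, (transOp g ρ)^[n] f s ∂ν - (transOp g ρ)^[n] f y₀) atTop (𝓝 0) := by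
    intro ν _
    have h1 : ∀ n, ∫ s, (transOp g ρ)^[n] f s ∂ν - (transOp g ρ)^[n] f y₀
        = ∫ s, ((transOp g ρ)^[n] f s - (transOp g ρ)^[n] f y₀) ∂ν := by
      intro n
      rw [integral_sub (integrable_of_abs_le (measurable_iterate_transOp hg hf n)
        (abs_iterate_transOp_le hg hL n)) (integrable_const _)]
      simp
    simp_rw [h1]
    have h2 := tendsto_integral_of_dominated_convergence (μ := ν) (f := fun _ => (0 : ℝ))
      (F := fun n s => (transOp g ρ)^[n] f s - (transOp g ρ)^[n] f y₀) (fun _ => L + L)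
      (fun n => ((measurable_iterate_transOp hg hf n).sub_const _).aestronglyMeasurable)
      (integrable_const _)
      (fun n => ae_of_all _ fun s => (abs_sub _ _).trans
        (add_le_add (abs_iterate_transOp_le hg hL n s) (abs_iterate_transOp_le hg hL n y₀)))
      (ae_of_all _ fun s => hpt s y₀)
    simpa using h2
  have hπf : ∀ n, ∫ s, f s ∂π = ∫ s, (transOp g ρ)^[n] f s ∂π := fun n =>
    integral_iterate_transOp (m := fun _ => π) hg (fun _ => inferInstance) (fun _ => hπ.symm)
      n hf hL
  have := hm 0
  have hdiff := (hint (m 0)).sub (hint π)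
  rw [sub_zero] at hdiff
  have hfin := hdiff.add_const (∫ s, f s ∂π)
  rw [zero_add] at hfin
  refine hfin.congr fun n => ?_
  rw [integral_iterate_transOp hg hm hstep n hf hL, hπf n]
  ring

end Harris

/-! ### Rayleigh fading -/

lemma lintegral_two_mul_exp_neg_sq {v t : ℝ} (hv : 0 < v) (ht : 0 ≤ t) :
    ∫⁻ r in Set.Ioi (Real.sqrt t), ENNReal.ofReal (2 * r / v * Real.exp (-(r ^ 2 / v)))
      = ENNReal.ofReal (Real.exp (-(t / v))) := by
  have hderiv : ∀ r ∈ Set.Ici (Real.sqrt t), HasDerivAt (fun r => -Real.exp (-(r ^ 2 / v)))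
      (2 * r / v * Real.exp (-(r ^ 2 / v))) r := by
    intro r _
    have h := (((hasDerivAt_pow 2 r).div_const v).neg.exp).neg
    convert! h using 1
    simp; ring
  have hnn : ∀ r ∈ Set.Ioi (Real.sqrt t), 0 ≤ 2 * r / v * Real.exp (-(r ^ 2 / v)) := by
    intro r hr
    have : 0 ≤ r := (Real.sqrt_nonneg t).trans (le_of_lt hr)
    positivity
  have hlim : Tendsto (fun r => -Real.exp (-(r ^ 2 / v))) atTop (𝓝 0) := by
    have h1 : Tendsto (fun r : ℝ => r ^ 2 / v) atTop atTop :=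
      (tendsto_pow_atTop two_ne_zero).atTop_div_const hv
    simpa using (Real.tendsto_exp_neg_atTop_nhds_zero.comp h1).neg
  have hint := integrableOn_Ioi_deriv_of_nonneg' hderiv hnn hlim
  have hval := integral_Ioi_of_hasDerivAt_of_nonneg' hderiv hnn hlim
  rw [← ofReal_integral_eq_lintegral_ofReal hint
    ((ae_restrict_iff' measurableSet_Ioi).2 (ae_of_all _ hnn)), hval, Real.sq_sqrt ht]
  simp

/-- In polar coordinates the joint density is e^{-r²/v}/(πv); the angle integrates out and leaves an
elementary radial integral. -/
lemma complexGaussian_le_normSq {v : ℝ≥0} (hv : 0 < v) {t : ℝ} (ht : 0 ≤ t) :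
    complexGaussian v {z | t ≤ ‖z‖ ^ 2} = ENNReal.ofReal (Real.exp (-(t / v))) := by
  have hv' : (0 : ℝ) < v := hv
  have hv2 : v / 2 ≠ 0 := by positivity
  have hmeas : Measurable fun p : ℝ × ℝ => (⟨p.1, p.2⟩ : ℂ) :=
    Complex.measurableEquivRealProd.symm.measurable
  have hset : MeasurableSet {z : ℂ | t ≤ ‖z‖ ^ 2} :=
    measurableSet_le measurable_const (measurable_norm.pow_const 2)
  have hset2 : MeasurableSet {p : ℝ × ℝ | t ≤ p.1 ^ 2 + p.2 ^ 2} :=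
    measurableSet_le measurable_const (by fun_prop)
  have hpre : (fun p : ℝ × ℝ => (⟨p.1, p.2⟩ : ℂ)) ⁻¹' {z | t ≤ ‖z‖ ^ 2}
      = {p | t ≤ p.1 ^ 2 + p.2 ^ 2} := by
    ext p
    simp only [Set.mem_preimage, Set.mem_ofPred_eq, Complex.sq_norm, Complex.normSq_apply]
    rw [sq, sq]
  rw [complexGaussian, Measure.map_apply hmeas hset, hpre, gaussianReal_of_var_ne_zero _ hv2,
    prod_withDensity (measurable_gaussianPDF _ _) (measurable_gaussianPDF _ _),
    withDensity_apply _ hset2, ← Measure.volume_eq_prod, ← lintegral_indicator hset2,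
    ← lintegral_comp_polarCoord_symm]
  have hf : ∀ p ∈ polarCoord.target, ENNReal.ofReal p.1 •
      Set.indicator {p : ℝ × ℝ | t ≤ p.1 ^ 2 + p.2 ^ 2}
        (fun z => gaussianPDF 0 (v / 2) z.1 * gaussianPDF 0 (v / 2) z.2) (polarCoord.symm p)
      = (Set.Ici (Real.sqrt t)).indicator (fun r => ENNReal.ofReal
          (2 * r / v * Real.exp (-(r ^ 2 / v)))) p.1 * ENNReal.ofReal (1 / (2 * Real.pi)) := by
    rintro ⟨r, θ⟩ ⟨hr, -⟩
    have hr : 0 < r := hr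
    have hsq : (r * Real.cos θ) ^ 2 + (r * Real.sin θ) ^ 2 = r ^ 2 := by
      linear_combination r ^ 2 * Real.cos_sq_add_sin_sq θ
    have hmem : Real.sqrt t ≤ r ↔ t ≤ r ^ 2 := Real.sqrt_le_left hr.le
    rw [polarCoord_symm_apply]
    by_cases h : t ≤ r ^ 2
    · rw [Set.indicator_of_mem (by simpa [hsq] using h),
        Set.indicator_of_mem (by simpa [hmem] using h), gaussianPDF, gaussianPDF, smul_eq_mul,
        ← ENNReal.ofReal_mul (gaussianPDFReal_nonneg _ _ _), ← ENNReal.ofReal_mul hr.le,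
        ← ENNReal.ofReal_mul (by positivity)]
      congr 1
      have h1 : gaussianPDFReal 0 (v / 2) (r * Real.cos θ) * gaussianPDFReal 0 (v / 2)
          (r * Real.sin θ) = (Real.pi * v)⁻¹ * Real.exp (-(r ^ 2 / v)) := by
        have h2 : 2 * Real.pi * ((v / 2 : ℝ≥0) : ℝ) = Real.pi * v := by push_cast; ring
        have h3 : Real.exp (-(r ^ 2 / v)) = Real.exp (-(r * Real.cos θ - 0) ^ 2
            / (2 * ((v / 2 : ℝ≥0) : ℝ))) * Real.exp (-(r * Real.sin θ - 0) ^ 2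
            / (2 * ((v / 2 : ℝ≥0) : ℝ))) := by
          rw [← Real.exp_add]
          congr 1
          push_cast
          rw [← hsq]
          field_simp
          ring
        have h4 : (Real.pi * v)⁻¹ = (√(Real.pi * v))⁻¹ * (√(Real.pi * v))⁻¹ := by
          rw [← mul_inv, Real.mul_self_sqrt (by positivity)]
        rw [gaussianPDFReal, gaussianPDFReal, h2, h3, h4]
        ring
      rw [h1]
      field_simp
    · rw [Set.indicator_of_notMem (by simpa [hsq] using h),
        Set.indicator_of_notMem (by simpa [hmem] using h)]
      simp
  have htarget : MeasurableSet polarCoord.target := polarCoord.open_target.measurableSet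
  rw [setLIntegral_congr_fun htarget hf, polarCoord_target, Measure.volume_eq_prod,
    ← Measure.prod_restrict]
  rw [lintegral_prod_mul (f := (Set.Ici (Real.sqrt t)).indicator (fun r => ENNReal.ofReal
          (2 * r / v * Real.exp (-(r ^ 2 / v))))) (g := fun _ => ENNReal.ofReal (1 / (2 * Real.pi)))
    (Measurable.indicator (by fun_prop) measurableSet_Ici).aemeasurable aemeasurable_const]
  rw [lintegral_const, Measure.restrict_apply_univ, Real.volume_Ioo,
    ← ENNReal.ofReal_mul (by positivity), lintegral_indicator measurableSet_Ici,
    Measure.restrict_restrict measurableSet_Ici]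
  have hae : (Set.Ici (Real.sqrt t) ∩ Set.Ioi 0 : Set ℝ) =ᵐ[volume] Set.Ioi (Real.sqrt t) := by
    have h1 : (Set.Ioi (Real.sqrt t) ∩ Set.Ioi 0 : Set ℝ) = Set.Ioi (Real.sqrt t) :=
      Set.inter_eq_left.2 (Set.Ioi_subset_Ioi (Real.sqrt_nonneg t))
    rw [← h1]
    exact (Ioi_ae_eq_Ici (μ := volume) (a := Real.sqrt t)).symm.inter (ae_eq_refl _)
  rw [Measure.restrict_congr_set hae, lintegral_two_mul_exp_neg_sq hv' ht]
  have : 1 / (2 * Real.pi) * (Real.pi - -Real.pi) = 1 := by field_simp; ring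
  rw [this]
  simp

lemma measurable_linkSNR (P σ : ℝ) : Measurable (linkSNR P σ) := by
  unfold linkSNR
  fun_prop

/-- The probability that the direct link is successful. -/
lemma complexGaussian_le_linkSNR {P σ d α : ℝ} (hP : 0 < P) (hσ : 0 < σ) (hd : 0 < d)
    (Γ : ℝ≥0∞) :
    complexGaussian (Real.toNNReal (d ^ (-α))) {z | Γ ≤ ENNReal.ofReal (linkSNR P σ z)}
      = ENNReal.ofReal (expNeg (W2 P σ d α) Γ) := by
  unfold expNeg
  split_ifs with hΓ
  · simp [hΓ]
  · have hset : {z : ℂ | Γ ≤ ENNReal.ofReal (linkSNR P σ z)}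
        = {z | Γ.toReal * σ ^ 2 / P ≤ ‖z‖ ^ 2} := by
      ext z
      have hnn : 0 ≤ linkSNR P σ z := by unfold linkSNR; positivity
      rw [Set.mem_ofPred_eq, Set.mem_ofPred_eq, ENNReal.le_ofReal_iff_toReal_le hΓ hnn, linkSNR,
        le_div_iff₀ (by positivity), div_le_iff₀ hP, mul_comm P]
    have hv : 0 < d ^ (-α) := Real.rpow_pos_of_pos hd _
    rw [hset, complexGaussian_le_normSq (by simpa using hv) (by positivity),
      Real.coe_toNNReal _ hv.le, Real.rpow_neg hd.le, W2]
    congr 3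
    have := (Real.rpow_pos_of_pos hd α).ne'
    field_simp

instance isProbabilityMeasure_complexGaussian (v : ℝ≥0) :
    IsProbabilityMeasure (complexGaussian v) :=
  Measure.isProbabilityMeasure_map
    Complex.measurableEquivRealProd.symm.measurable.aemeasurable

/-! ### The exponential distribution -/

lemma expMeasure_eq_withDensity (r : ℝ) :
    expMeasure r = volume.withDensity (exponentialPDF r) := rfl

lemma measurable_exponentialPDF (r : ℝ) : Measurable (exponentialPDF r) :=
  (measurable_exponentialPDFReal r).ennreal_ofReal

lemma ae_nonneg_expMeasure (r : ℝ) : ∀ᵐ x ∂expMeasure r, 0 ≤ x := by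
  rw [expMeasure_eq_withDensity, ae_withDensity_iff (measurable_exponentialPDF r)]
  refine ae_of_all _ fun x hx => ?_
  by_contra h
  exact hx (exponentialPDF_of_neg (not_le.1 h))

/-- The laws of `c + X`, `0 ≤ c ≤ C`, with `X` exponential, have a common component. -/
lemma restrict_Ici_expMeasure_le {r : ℝ} (hr : 0 < r) {c C : ℝ} (hc : 0 ≤ c) (hcC : c ≤ C) :
    (expMeasure r).restrict (Set.Ici C) ≤ (expMeasure r).map (fun x => c + x) := by
  refine Measure.le_iff.2 fun A hA => ?_
  have hsh : Measurable fun x : ℝ => c + x := by fun_prop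
  rw [Measure.restrict_apply hA, Measure.map_apply hsh hA, expMeasure_eq_withDensity,
    withDensity_apply _ (hA.inter measurableSet_Ici), withDensity_apply _ (hsh hA),
    ← lintegral_indicator (hA.inter measurableSet_Ici), ← lintegral_indicator (hsh hA),
    ← lintegral_sub_right_eq_self
      (fun x => ((fun x => c + x) ⁻¹' A).indicator (exponentialPDF r) x) c]
  refine lintegral_mono fun y => ?_
  -- For y ≥ C ≥ c the density re^{-r(y-c)} of c + X is at least re^{-ry}.
  by_cases hy : y ∈ A ∩ Set.Ici C
  · have hyA : y - c ∈ (fun x => c + x) ⁻¹' A := by simpa using hy.1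
    have hyC : C ≤ y := hy.2
    rw [Set.indicator_of_mem hy, Set.indicator_of_mem hyA,
      exponentialPDF_of_nonneg (by linarith), exponentialPDF_of_nonneg (by linarith)]
    refine ENNReal.ofReal_le_ofReal ?_
    gcongr
    linarith
  · rw [Set.indicator_of_notMem hy]
    exact zero_le

lemma expMeasure_restrict_Ici_ne_zero {r : ℝ} (hr : 0 < r) {C : ℝ} (hC : 0 ≤ C) :
    (expMeasure r).restrict (Set.Ici C) ≠ 0 := by
  intro h
  have := isProbabilityMeasure_expMeasure hr
  rw [Measure.restrict_eq_zero] at h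
  have h1 : cdf (expMeasure r) C = 1 := by
    rw [cdf_eq_real, measureReal_def, ← Set.compl_Ioi, prob_compl_eq_one_sub measurableSet_Ioi,
      measure_mono_null Set.Ioi_subset_Ici_self h]
    simp
  rw [cdf_expMeasure_eq hr, if_pos hC] at h1
  have := Real.exp_pos (-(r * C))
  linarith

lemma integrable_exp_mul_expMeasure {r θ : ℝ} (hr : 0 < r) (hθ : θ < r) :
    Integrable (fun x => Real.exp (θ * x)) (expMeasure r) ∧
      ∫ x, Real.exp (θ * x) ∂expMeasure r = r / (r - θ) := by
  have hae : ∀ᵐ x : ℝ, (exponentialPDF r x).toReal • Real.exp (θ * x)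
      = (Set.Ioi (0 : ℝ)).indicator (fun x => r * Real.exp ((θ - r) * x)) x := by
    filter_upwards [Measure.ae_ne volume (0 : ℝ)] with x hx0
    obtain hx | hx := lt_or_gt_of_ne hx0
    · rw [exponentialPDF_of_neg hx, Set.indicator_of_notMem (by simpa using hx.le)]
      simp
    · rw [exponentialPDF_of_nonneg hx.le, Set.indicator_of_mem (by simpa using hx),
        ENNReal.toReal_ofReal (by positivity), smul_eq_mul, mul_assoc, ← Real.exp_add]
      ring_nf
  have hlt : ∀ᵐ x : ℝ, exponentialPDF r x < ∞ := ae_of_all _ fun x => ENNReal.ofReal_lt_top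
  have hneg : θ - r < 0 := by linarith
  rw [expMeasure_eq_withDensity]
  constructor
  · rw [integrable_withDensity_iff_integrable_smul' (measurable_exponentialPDF r) hlt,
      integrable_congr hae, integrable_indicator_iff measurableSet_Ioi]
    exact (integrableOn_exp_mul_Ioi hneg 0).const_mul r
  · rw [integral_withDensity_eq_integral_toReal_smul (measurable_exponentialPDF r) hlt,
      integral_congr_ae hae, integral_indicator measurableSet_Ioi, integral_const_mul,
      integral_exp_mul_Ioi hneg 0]
    have h1 : r - θ ≠ 0 := by linarith
    have h2 : θ - r ≠ 0 := by linarith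
    simp only [mul_zero, Real.exp_zero]
    field_simp
    ring

/-! ### The exponent -/

/-- `invFunOn` is meaningful only if a preimage exists in [-1, ∞). One does, by the intermediate
value theorem on [-1, 0], since φe^{-φ} ≤ e^{-1}. -/
lemma lambertW_spec {φ : ℝ} (hφ : 1 < φ) :
    -1 ≤ lambertW (-φ * Real.exp (-φ)) ∧ lambertW (-φ * Real.exp (-φ)) < 0 ∧
      lambertW (-φ * Real.exp (-φ)) * Real.exp (lambertW (-φ * Real.exp (-φ)))
        = -φ * Real.exp (-φ) := by
  have hle : φ * Real.exp (-φ) ≤ Real.exp (-1) := by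
    have h1 : φ ≤ Real.exp (φ - 1) := by linarith [Real.add_one_le_exp (φ - 1)]
    calc φ * Real.exp (-φ) ≤ Real.exp (φ - 1) * Real.exp (-φ) := by gcongr
      _ = Real.exp (-1) := by rw [← Real.exp_add]; ring_nf
  have hpos : 0 < φ * Real.exp (-φ) := by positivity
  have hex : ∃ w ∈ Set.Ici (-1 : ℝ), w * Real.exp w = -φ * Real.exp (-φ) := by
    have hc : ContinuousOn (fun w : ℝ => w * Real.exp w) (Set.Icc (-1) 0) := by fun_prop
    obtain ⟨w, hw, hw'⟩ := intermediate_value_Icc (by norm_num) hc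
      (show -φ * Real.exp (-φ) ∈ Set.Icc _ _ from
        ⟨by simp only [neg_mul, one_mul]; linarith, by simp only [zero_mul, neg_mul]; linarith⟩)
    exact ⟨w, hw.1, hw'⟩
  have h1 := Function.invFunOn_mem hex
  have h2 : lambertW (-φ * Real.exp (-φ)) * Real.exp (lambertW (-φ * Real.exp (-φ)))
      = -φ * Real.exp (-φ) := Function.invFunOn_eq hex
  refine ⟨h1, ?_, h2⟩
  by_contra h3
  have := mul_nonneg (not_lt.1 h3) (Real.exp_pos (lambertW (-φ * Real.exp (-φ)))).le
  linarith

/-- Dividing We^W = -φe^{-φ} by e^W gives the exponent equation; W ≥ -1 > -φ gives the sign, as QM =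
-W - φ. -/
lemma Q_spec {M lam w : ℝ} {Γ : ℝ≥0∞} (hM : 0 < M) (hφ : 1 < phiInc M lam w Γ) :
    Q M lam w Γ < 0 ∧ Q M lam w Γ + lam * (1 - expNeg w Γ)
      = lam * (1 - expNeg w Γ) * Real.exp (Q M lam w Γ * M) := by
  set φ := phiInc M lam w Γ with hφdef
  obtain ⟨h1, h2, h3⟩ := lambertW_spec hφ
  have hφ' : (1 - expNeg w Γ) * lam * M = φ := by rw [hφdef, phiInc]; ring
  set W := lambertW (-φ * Real.exp (-φ)) with hW
  have hQ : Q M lam w Γ = -(W / M) - φ / M := by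
    rw [Q, hφ', ← hW, ← hφ']; field_simp
  have hQM : Q M lam w Γ * M = -W - φ := by rw [hQ]; field_simp
  constructor
  · have : Q M lam w Γ * M < 0 := by rw [hQM]; linarith
    exact neg_of_mul_neg_left this hM.le
  · have hexp : φ * Real.exp (-W - φ) = -W := by
      rw [sub_eq_add_neg, Real.exp_add]
      have : Real.exp (-W) * Real.exp W = 1 := by rw [← Real.exp_add]; simp
      linear_combination Real.exp (-W) * h3 - W * this
    have hl : lam * (1 - expNeg w Γ) = φ / M := by rw [← hφ']; field_simp
    rw [hQM, hl, hQ, div_mul_eq_mul_div, hexp]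
    ring

lemma expNeg_nonneg (w : ℝ) (Γ : ℝ≥0∞) : 0 ≤ expNeg w Γ := by
  unfold expNeg; split_ifs <;> positivity

lemma one_sub_expNeg_pos {M lam w : ℝ} {Γ : ℝ≥0∞} (hM : 0 < M) (hlam : 0 < lam)
    (hφ : 1 < phiInc M lam w Γ) : 0 < 1 - expNeg w Γ :=
  pos_of_mul_pos_right (zero_lt_one.trans hφ) (by positivity)

/-! ### The limiting density -/

/-- The limiting density with probability of transmission `p` and exponent `Q`. -/
noncomputable def bufferDensity (M lam p Q x : ℝ) : ℝ :=
  if x < 0 then 0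
  else if x < M then (1 - Real.exp (Q * x)) / M
  else -Q * Real.exp (Q * x) / (M * (Q + lam * p))

section Density

variable {M lam p Q : ℝ}

lemma bufferDensity_of_nonpos (hM : 0 < M) {x : ℝ} (hx : x ≤ 0) :
    bufferDensity M lam p Q x = 0 := by
  obtain h | rfl := hx.lt_or_eq
  · simp [bufferDensity, h]
  · simp [bufferDensity, hM]

/-- The exponent equation makes the two branches agree at M, so the lower formula extends to the
closed interval and the density is continuous. -/
lemma bufferDensity_of_mem_Icc (hM : 0 < M) (hlam : 0 < lam) (hp : 0 < p)
    (hkey : Q + lam * p = lam * p * Real.exp (Q * M)) {x : ℝ} (hx0 : 0 ≤ x) (hxM : x ≤ M) :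
    bufferDensity M lam p Q x = (1 - Real.exp (Q * x)) / M := by
  rw [bufferDensity, if_neg hx0.not_gt]
  split_ifs with h
  · rfl
  · obtain rfl : x = M := le_antisymm hxM (not_lt.1 h)
    have h1 := (Real.exp_pos (Q * x)).ne'
    have h2 : -Q = lam * p * (1 - Real.exp (Q * x)) := by linear_combination -hkey
    rw [hkey, h2]
    field_simp

lemma bufferDensity_of_le (hM : 0 < M) (hkey : Q + lam * p = lam * p * Real.exp (Q * M)) {x : ℝ}
    (hx : M ≤ x) :
    bufferDensity M lam p Q x = -Q / (M * (lam * p * Real.exp (Q * M))) * Real.exp (Q * x) := by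
  rw [bufferDensity, if_neg (by linarith), if_neg hx.not_gt, hkey]
  ring

lemma bufferDensity_nonneg (hM : 0 < M) (hlam : 0 < lam) (hp : 0 < p) (hQ : Q < 0)
    (hkey : Q + lam * p = lam * p * Real.exp (Q * M)) (x : ℝ) : 0 ≤ bufferDensity M lam p Q x := by
  obtain h | h := le_total x 0
  · rw [bufferDensity_of_nonpos hM h]
  obtain h' | h' := le_total x M
  · rw [bufferDensity_of_mem_Icc hM hlam hp hkey h h']
    have : Real.exp (Q * x) ≤ 1 := Real.exp_le_one_iff.2 (mul_nonpos_of_nonpos_of_nonneg hQ.le h)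
    exact div_nonneg (by linarith) hM.le
  · rw [bufferDensity_of_le hM hkey h']
    have : 0 < -Q := by linarith
    positivity

lemma continuous_bufferDensity (hM : 0 < M) (hlam : 0 < lam) (hp : 0 < p)
    (hkey : Q + lam * p = lam * p * Real.exp (Q * M)) : Continuous (bufferDensity M lam p Q) := by
  have h : bufferDensity M lam p Q = fun x => if x ≤ 0 then 0 else if x ≤ M then
      (1 - Real.exp (Q * x)) / M else
      -Q / (M * (lam * p * Real.exp (Q * M))) * Real.exp (Q * x) := by
    ext x
    split_ifs with h1 h2
    · exact bufferDensity_of_nonpos hM h1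
    · exact bufferDensity_of_mem_Icc hM hlam hp hkey (not_le.1 h1).le h2
    · exact bufferDensity_of_le hM hkey (not_le.1 h2).le
  rw [h]
  refine Continuous.if_le continuous_const (Continuous.if_le (by fun_prop) (by fun_prop)
    continuous_id continuous_const ?_) continuous_id continuous_const ?_
  · rintro x rfl
    rw [← bufferDensity_of_mem_Icc hM hlam hp hkey hM.le le_rfl, bufferDensity_of_le hM hkey le_rfl]
  · rintro x rfl
    simp [hM.le]

/-- This is g' = λ(T - g): energy below M is never drained, and drained energy arrives from x + M,
so T(x) = g(x) + p g(x+M). -/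
lemma hasDerivAt_bufferDensity_of_mem_Ioo (hM : 0 < M) (hlam : 0 < lam) (hp : 0 < p)
    (hkey : Q + lam * p = lam * p * Real.exp (Q * M)) {x : ℝ} (hx : x ∈ Set.Ioo 0 M) :
    HasDerivAt (bufferDensity M lam p Q) (lam * p * bufferDensity M lam p Q (x + M)) x := by
  have h1 : HasDerivAt (fun x => (1 - Real.exp (Q * x)) / M)
      (lam * p * bufferDensity M lam p Q (x + M)) x := by
    have h := ((((hasDerivAt_id x).const_mul Q).exp).const_sub 1).div_const M
    convert! h using 1
    rw [bufferDensity_of_le hM hkey (by linarith [hx.1]), mul_add, Real.exp_add]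
    simp only [id_eq]
    field_simp
  refine h1.congr_of_eventuallyEq ?_
  filter_upwards [isOpen_Ioo.mem_nhds hx] with y hy
  exact bufferDensity_of_mem_Icc hM hlam hp hkey hy.1.le hy.2.le

/-- Above M a failed link also removes mass: T(x) = (1 - p)g(x) + p g(x+M). -/
lemma hasDerivAt_bufferDensity_of_lt (hM : 0 < M)
    (hkey : Q + lam * p = lam * p * Real.exp (Q * M)) {x : ℝ} (hx : M < x) :
    HasDerivAt (bufferDensity M lam p Q)
      (lam * p * (bufferDensity M lam p Q (x + M) - bufferDensity M lam p Q x)) x := by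
  have h1 : HasDerivAt
      (fun x => -Q / (M * (lam * p * Real.exp (Q * M))) * Real.exp (Q * x))
      (lam * p * (bufferDensity M lam p Q (x + M) - bufferDensity M lam p Q x)) x := by
    have h := (((hasDerivAt_id x).const_mul Q).exp).const_mul
      (-Q / (M * (lam * p * Real.exp (Q * M))))
    convert! h using 1
    rw [bufferDensity_of_le hM hkey (by linarith), bufferDensity_of_le hM hkey hx.le, mul_add,
      Real.exp_add]
    simp only [id_eq]
    have : Q = lam * p * Real.exp (Q * M) - lam * p := by linarith
    linear_combination (-(-Q / (M * (lam * p * Real.exp (Q * M))) * Real.exp (Q * x))) * this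
  refine h1.congr_of_eventuallyEq ?_
  filter_upwards [isOpen_Ioi.mem_nhds hx] with y hy
  exact bufferDensity_of_le hM hkey (le_of_lt hy)

/-- Integration by parts against `1 - exp (-lam (x - u))`. -/
lemma integral_one_sub_exp_mul {g T : ℝ → ℝ} {a b x : ℝ} (hlam : 0 < lam) (hab : a ≤ b)
    (hg : Continuous g) (hT : Continuous T)
    (hderiv : ∀ u ∈ Set.Ioo a b, HasDerivAt g (lam * (T u - g u)) u) :
    ∫ u in a..b, (1 - Real.exp (-(lam * (x - u)))) * T u
      = ((1 - Real.exp (-(lam * (x - b)))) * g b - (1 - Real.exp (-(lam * (x - a)))) * g a) / lam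
        + ∫ u in a..b, g u := by
  have hE : Continuous fun u => Real.exp (-(lam * (x - u))) := by fun_prop
  have h := intervalIntegral.integral_eq_sub_of_hasDeriv_right_of_le hab
    (f := fun u => (1 - Real.exp (-(lam * (x - u)))) * g u)
    (f' := fun u => lam * ((1 - Real.exp (-(lam * (x - u)))) * T u) - lam * g u)
    (by fun_prop) (fun u hu => by
      have h1 : HasDerivAt (fun u => 1 - Real.exp (-(lam * (x - u))))
          (-(lam * Real.exp (-(lam * (x - u))))) u := by
        have h2 := ((((hasDerivAt_id u).const_sub x).const_mul lam).neg.exp).const_sub 1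
        convert! h2 using 1
        simp; ring
      have h3 := h1.mul (hderiv u hu)
      refine HasDerivAt.hasDerivWithinAt ?_
      convert! h3 using 1
      ring)
    (Continuous.intervalIntegrable (by fun_prop) _ _)
  rw [intervalIntegral.integral_sub (Continuous.intervalIntegrable (by fun_prop) _ _)
    (Continuous.intervalIntegrable (by fun_prop) _ _), intervalIntegral.integral_const_mul,
    intervalIntegral.integral_const_mul] at h
  rw [← h]
  field_simp
  ring

/-- The stationarity equation for the limiting density. -/
lemma integral_bufferDensity_eq (hM : 0 < M) (hlam : 0 < lam) (hp : 0 < p)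
    (hkey : Q + lam * p = lam * p * Real.exp (Q * M)) {x : ℝ} (hx : 0 ≤ x) :
    (1 - p) * (∫ u in (0 : ℝ)..x, cdf (expMeasure lam) (x - u) * bufferDensity M lam p Q u)
      + p * ((∫ u in M..(M + x), cdf (expMeasure lam) (x - u + M) * bufferDensity M lam p Q u)
        + ∫ u in (0 : ℝ)..(min x M), cdf (expMeasure lam) (x - u) * bufferDensity M lam p Q u)
      = ∫ u in (0 : ℝ)..x, bufferDensity M lam p Q u := by
  set g := bufferDensity M lam p Q with hgdef
  have hg : Continuous g := continuous_bufferDensity hM hlam hp hkey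
  have hg' : Continuous fun u => g (u + M) := by fun_prop
  set F : ℝ → ℝ := fun u => 1 - Real.exp (-(lam * (x - u))) with hF
  have hFc : Continuous F := by fun_prop
  have hcdf : ∀ u, u ≤ x → cdf (expMeasure lam) (x - u) = F u := fun u hu => by
    rw [cdf_expMeasure_eq hlam, if_pos (by linarith)]
  have e1 : ∀ b, 0 ≤ b → b ≤ x → ∫ u in (0 : ℝ)..b, cdf (expMeasure lam) (x - u) * g u
      = ∫ u in (0 : ℝ)..b, F u * g u := by
    intro b hb hbx
    refine intervalIntegral.integral_congr fun u hu => ?_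
    rw [Set.uIcc_of_le hb] at hu
    rw [hcdf u (hu.2.trans hbx)]
  have e2 : ∫ u in M..(M + x), cdf (expMeasure lam) (x - u + M) * g u
      = ∫ u in (0 : ℝ)..x, F u * g (u + M) := by
    have h := intervalIntegral.integral_comp_add_right (a := 0) (b := x)
      (fun u => cdf (expMeasure lam) (x - u + M) * g u) M
    rw [zero_add, add_comm x M] at h
    rw [← h]
    refine intervalIntegral.integral_congr fun u hu => ?_
    rw [Set.uIcc_of_le hx] at hu
    rw [← hcdf u hu.2]
    ring_nf
  have hint1 : ∀ a b, IntervalIntegrable (fun u => F u * g u) volume a b := fun a b =>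
    (hFc.mul hg).intervalIntegrable a b
  have hint2 : ∀ a b, IntervalIntegrable (fun u => F u * g (u + M)) volume a b := fun a b =>
    (hFc.mul hg').intervalIntegrable a b
  have low : ∀ b, 0 ≤ b → b ≤ M → (∫ u in (0 : ℝ)..b, F u * g u)
      + p * (∫ u in (0 : ℝ)..b, F u * g (u + M)) = F b * g b / lam + ∫ u in (0 : ℝ)..b, g u := by
    intro b hb hbM
    have h := integral_one_sub_exp_mul (x := x) (T := fun u => g u + p * g (u + M)) hlam hb hg
      (by fun_prop) (fun u hu => by
        convert! hasDerivAt_bufferDensity_of_mem_Ioo hM hlam hp hkey ⟨hu.1, hu.2.trans_le hbM⟩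
          using 1
        ring)
    have h0 : g 0 = 0 := bufferDensity_of_nonpos hM le_rfl
    rw [h0, mul_zero, sub_zero] at h
    rw [← h, ← intervalIntegral.integral_const_mul, ← intervalIntegral.integral_add (hint1 _ _)
      ((hint2 _ _).const_mul p)]
    refine intervalIntegral.integral_congr fun u _ => ?_
    simp only [hF]
    ring
  have hFx : F x = 0 := by simp [hF]
  rw [e1 x hx le_rfl, e2, e1 _ (le_min hx hM.le) (min_le_left _ _)]
  obtain hxM | hMx := le_total x M
  · rw [min_eq_left hxM]
    have h := low x hx hxM
    rw [hFx, zero_mul, zero_div, zero_add] at h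
    linear_combination h
  -- T changes its formula at M, so the parts below and above M are integrated separately; their
  -- boundary terms at M cancel, g being continuous.
  · rw [min_eq_right hMx]
    have h := low M hM.le le_rfl
    have h' := integral_one_sub_exp_mul (x := x) (T := fun u => (1 - p) * g u + p * g (u + M)) hlam
      hMx hg (by fun_prop) (fun u hu => by
        convert! hasDerivAt_bufferDensity_of_lt hM hkey hu.1 using 1
        ring)
    have h'' : ∫ u in M..x, (1 - Real.exp (-(lam * (x - u)))) * ((1 - p) * g u + p * g (u + M))
        = (1 - p) * (∫ u in M..x, F u * g u) + p * ∫ u in M..x, F u * g (u + M) := by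
      rw [← intervalIntegral.integral_const_mul, ← intervalIntegral.integral_const_mul,
        ← intervalIntegral.integral_add ((hint1 _ _).const_mul _) ((hint2 _ _).const_mul p)]
      refine intervalIntegral.integral_congr fun u _ => ?_
      simp only [hF]
      ring
    have hFM : F M = 1 - Real.exp (-(lam * (x - M))) := rfl
    rw [h'', ← hFM, show 1 - Real.exp (-(lam * (x - x))) = 0 by simp] at h'
    have a1 := intervalIntegral.integral_add_adjacent_intervals (hint1 0 M) (hint1 M x)
    have a2 := intervalIntegral.integral_add_adjacent_intervals (hint2 0 M) (hint2 M x)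
    have a3 := intervalIntegral.integral_add_adjacent_intervals (μ := volume)
      (hg.intervalIntegrable 0 M) (hg.intervalIntegrable M x)
    rw [← a1, ← a2, ← a3]
    linear_combination h + h'

/-- The tail beyond M has mass 1/(Mλp) and [0, M] has mass 1 - (e^{QM} - 1)/(QM); they sum to 1
exactly by the exponent equation. -/
lemma integrable_bufferDensity (hM : 0 < M) (hlam : 0 < lam) (hp : 0 < p) (hQ : Q < 0)
    (hkey : Q + lam * p = lam * p * Real.exp (Q * M)) :
    Integrable (bufferDensity M lam p Q) ∧ ∫ x, bufferDensity M lam p Q x = 1 := by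
  have hg : Continuous (bufferDensity M lam p Q) := continuous_bufferDensity hM hlam hp hkey
  have h0 : Set.EqOn (bufferDensity M lam p Q) (fun _ => 0) (Set.Iic 0) :=
    fun x hx => bufferDensity_of_nonpos hM hx
  have h2 : Set.EqOn (bufferDensity M lam p Q)
      (fun x => -Q / (M * (lam * p * Real.exp (Q * M))) * Real.exp (Q * x)) (Set.Ioi M) :=
    fun x hx => bufferDensity_of_le hM hkey (le_of_lt hx)
  have i0 : IntegrableOn (bufferDensity M lam p Q) (Set.Iic 0) :=
    (integrableOn_congr_fun h0 measurableSet_Iic).2 integrableOn_zero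
  have i1 : IntegrableOn (bufferDensity M lam p Q) (Set.Ioc 0 M) :=
    (hg.integrableOn_Icc).mono_set Set.Ioc_subset_Icc_self
  have i2 : IntegrableOn (bufferDensity M lam p Q) (Set.Ioi M) :=
    (integrableOn_congr_fun h2 measurableSet_Ioi).2 ((integrableOn_exp_mul_Ioi hQ M).const_mul _)
  have i12 : IntegrableOn (bufferDensity M lam p Q) (Set.Ioi 0) := by
    rw [← Set.Ioc_union_Ioi_eq_Ioi hM.le]
    exact i1.union i2
  have hint : Integrable (bufferDensity M lam p Q) := by
    rw [← integrableOn_univ, ← Set.Iic_union_Ioi (a := (0 : ℝ))]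
    exact i0.union i12
  refine ⟨hint, ?_⟩
  rw [← intervalIntegral.integral_Iic_add_Ioi i0 i12, setIntegral_congr_fun measurableSet_Iic h0,
    ← Set.Ioc_union_Ioi_eq_Ioi hM.le, setIntegral_union (Set.Ioc_disjoint_Ioi le_rfl)
      measurableSet_Ioi i1 i2, setIntegral_congr_fun measurableSet_Ioi h2, integral_const_mul,
    integral_exp_mul_Ioi hQ, ← intervalIntegral.integral_of_le hM.le]
  have h1 : ∫ x in (0 : ℝ)..M, bufferDensity M lam p Q x
      = ∫ x in (0 : ℝ)..M, (1 - Real.exp (Q * x)) / M := by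
    refine intervalIntegral.integral_congr fun u hu => ?_
    rw [Set.uIcc_of_le hM.le] at hu
    exact bufferDensity_of_mem_Icc hM hlam hp hkey hu.1 hu.2
  rw [h1, intervalIntegral.integral_div, intervalIntegral.integral_sub (by simp)
    (Continuous.intervalIntegrable (by fun_prop) _ _), intervalIntegral.integral_comp_mul_left _
    hQ.ne]
  have h3 := (Real.exp_pos (Q * M)).ne'
  have hQ0 := hQ.ne
  simp only [integral_zero, intervalIntegral.integral_const, integral_exp, mul_zero,
    Real.exp_zero, smul_eq_mul]
  field_simp
  rw [mul_comm M Q]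
  linear_combination hkey

end Density

/-! ### The transition law of the buffer -/

/-- The buffer update as a function of the stored energy (negative values are replaced by `0`) and
of the pair of harvested energy and channel gain. -/
noncomputable def stepMap (M : ℝ) (Γ : ℝ≥0∞) (P σ : ℝ) (z : ℝ × ℝ × ℂ) : ℝ :=
  bufferStep M Γ (max z.1 0) z.2.1 (linkSNR P σ z.2.2)

/-- The stored energy after a possible relay transmission. -/
noncomputable def drained (M b : ℝ) : ℝ := if M ≤ b then b - M else b

lemma measurable_stepMap (M : ℝ) (Γ : ℝ≥0∞) (P σ : ℝ) : Measurable (stepMap M Γ P σ) := by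
  have h : Measurable fun z : ℝ × ℝ × ℂ => linkSNR P σ z.2.2 :=
    (measurable_linkSNR P σ).comp (by fun_prop)
  unfold stepMap bufferStep
  refine Measurable.ite (measurableSet_le measurable_const h.ennreal_ofReal) (by fun_prop)
    (Measurable.ite (measurableSet_le measurable_const (by fun_prop)) (by fun_prop) (by fun_prop))

lemma measurable_drained (M : ℝ) : Measurable (drained M) :=
  Measurable.ite measurableSet_Ici (by fun_prop) (by fun_prop)

lemma drained_nonneg {M b : ℝ} (hb : 0 ≤ b) : 0 ≤ drained M b := by
  unfold drained; split_ifs <;> linarith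

lemma drained_le {M b : ℝ} (hM : 0 < M) : drained M b ≤ b := by
  unfold drained; split_ifs <;> linarith

section Transition

variable {M lam P σ w : ℝ} {Γ : ℝ≥0∞} {κ : Measure ℂ} [IsProbabilityMeasure κ]

lemma map_stepMap (hlam : 0 < lam)
    (hκ : κ {z | Γ ≤ ENNReal.ofReal (linkSNR P σ z)} = ENNReal.ofReal (expNeg w Γ)) (b : ℝ) :
    ((expMeasure lam).prod κ).map (fun e => stepMap M Γ P σ (b, e))
      = ENNReal.ofReal (expNeg w Γ) • (expMeasure lam).map (fun x => max b 0 + x)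
        + ENNReal.ofReal (1 - expNeg w Γ) •
          (expMeasure lam).map (fun x => drained M (max b 0) + x) := by
  have := isProbabilityMeasure_expMeasure hlam
  set U : Set ℂ := {z | Γ ≤ ENNReal.ofReal (linkSNR P σ z)} with hUdef
  have hU : MeasurableSet U :=
    measurableSet_le measurable_const (measurable_linkSNR P σ).ennreal_ofReal
  have hUc : κ Uᶜ = ENNReal.ofReal (1 - expNeg w Γ) := by
    rw [prob_compl_eq_one_sub hU, hκ, ENNReal.ofReal_sub _ (expNeg_nonneg w Γ), ENNReal.ofReal_one]
  have hg : Measurable fun e => stepMap M Γ P σ (b, e) :=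
    (measurable_stepMap M Γ P σ).comp measurable_prodMk_left
  ext A hA
  rw [Measure.map_apply hg hA, Measure.prod_apply_symm (hg hA), Measure.add_apply,
    Measure.smul_apply, Measure.smul_apply, Measure.map_apply (by fun_prop) hA,
    Measure.map_apply (by fun_prop) hA, ← lintegral_add_compl _ hU]
  have h1 : ∀ z ∈ U, expMeasure lam ((fun x => (x, z)) ⁻¹'
      ((fun e => stepMap M Γ P σ (b, e)) ⁻¹' A))
      = expMeasure lam ((fun x => max b 0 + x) ⁻¹' A) := by
    intro z hz
    congr 1
    ext x
    have hz' : Γ ≤ ENNReal.ofReal (linkSNR P σ z) := hz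
    simp only [Set.mem_preimage, stepMap, bufferStep, if_pos hz']
  have h2 : ∀ z ∈ Uᶜ, expMeasure lam ((fun x => (x, z)) ⁻¹'
      ((fun e => stepMap M Γ P σ (b, e)) ⁻¹' A))
      = expMeasure lam ((fun x => drained M (max b 0) + x) ⁻¹' A) := by
    intro z hz
    congr 1
    ext x
    have hz' : ¬ Γ ≤ ENNReal.ofReal (linkSNR P σ z) := hz
    simp only [Set.mem_preimage, stepMap, bufferStep, if_neg hz', drained]
    split_ifs <;> rfl
  rw [setLIntegral_congr_fun hU h1, setLIntegral_congr_fun hU.compl h2, setLIntegral_const,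
    setLIntegral_const, hκ, hUc, smul_eq_mul, smul_eq_mul, mul_comm, mul_comm (expMeasure lam _)]

/-- The Lyapunov function. -/
noncomputable def lyapunov (θ b : ℝ) : ℝ := Real.exp (θ * max b 0)

lemma integral_lyapunov_map_add {θ c : ℝ} (hlam : 0 < lam) (hθ : θ < lam) (hc : 0 ≤ c) :
    Integrable (lyapunov θ) ((expMeasure lam).map fun x => c + x) ∧
      ∫ s, lyapunov θ s ∂((expMeasure lam).map fun x => c + x)
        = lam / (lam - θ) * Real.exp (θ * c) := by
  have hm : Measurable (lyapunov θ) := by unfold lyapunov; fun_prop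
  have hs : Measurable fun x : ℝ => c + x := by fun_prop
  have hae : (fun x => lyapunov θ (c + x)) =ᵐ[expMeasure lam]
      fun x => Real.exp (θ * c) * Real.exp (θ * x) := by
    filter_upwards [ae_nonneg_expMeasure lam] with x hx
    rw [lyapunov, max_eq_left (by linarith), mul_add, Real.exp_add]
  obtain ⟨h1, h2⟩ := integrable_exp_mul_expMeasure hlam hθ
  rw [integrable_map_measure hm.aestronglyMeasurable hs.aemeasurable,
    integral_map hs.aemeasurable hm.aestronglyMeasurable]
  constructor
  · exact (integrable_congr hae).2 (h1.const_mul _)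
  · rw [integral_congr_ae hae, integral_const_mul, h2, mul_comm]

/-- Harvesting multiplies e^{θb} by λ/(λ-θ) on average, and draining multiplies it by e^{-θM}. The
additive constant covers b < M, where nothing is drained. -/
lemma lyapunov_drift (hlam : 0 < lam) (hp : 0 ≤ 1 - expNeg w Γ)
    (hκ : κ {z | Γ ≤ ENNReal.ofReal (linkSNR P σ z)} = ENNReal.ofReal (expNeg w Γ))
    {θ : ℝ} (hθ0 : 0 ≤ θ) (hθ : θ < lam) (b : ℝ) :
    Integrable (lyapunov θ) (((expMeasure lam).prod κ).map fun e => stepMap M Γ P σ (b, e)) ∧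
      transOp (stepMap M Γ P σ) ((expMeasure lam).prod κ) (lyapunov θ) b
        ≤ lam / (lam - θ) * (expNeg w Γ + (1 - expNeg w Γ) * Real.exp (-(θ * M)))
            * lyapunov θ b + lam / (lam - θ) * Real.exp (θ * M) := by
  have hb0 : 0 ≤ max b 0 := le_max_right _ _
  obtain ⟨i1, e1⟩ := integral_lyapunov_map_add hlam hθ hb0
  obtain ⟨i2, e2⟩ := integral_lyapunov_map_add hlam hθ (drained_nonneg (M := M) hb0)
  have j1 := i1.smul_measure (c := ENNReal.ofReal (expNeg w Γ)) ENNReal.ofReal_ne_top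
  have j2 := i2.smul_measure (c := ENNReal.ofReal (1 - expNeg w Γ)) ENNReal.ofReal_ne_top
  have hq := expNeg_nonneg w Γ
  rw [transOp, map_stepMap hlam hκ]
  refine ⟨j1.add_measure j2, ?_⟩
  rw [integral_add_measure j1 j2, integral_smul_measure, integral_smul_measure, e1, e2,
    ENNReal.toReal_ofReal hq, ENNReal.toReal_ofReal hp, smul_eq_mul, smul_eq_mul]
  have hL : 0 < lam / (lam - θ) := div_pos hlam (by linarith)
  set q := expNeg w Γ
  rw [lyapunov]
  set c := max b 0
  have hexp : Real.exp (θ * drained M c) ≤ Real.exp (-(θ * M)) * Real.exp (θ * c)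
      + Real.exp (θ * M) := by
    unfold drained
    split_ifs with h
    · rw [← Real.exp_add]
      have : θ * (c - M) = -(θ * M) + θ * c := by ring
      rw [this]
      linarith [Real.exp_pos (θ * M)]
    · have : Real.exp (θ * c) ≤ Real.exp (θ * M) := by
        gcongr
        exact (not_le.1 h).le
      have : 0 < Real.exp (-(θ * M)) * Real.exp (θ * c) := by positivity
      linarith
  have hp1 : 1 - q ≤ 1 := by linarith
  have h3 : (1 - q) * Real.exp (θ * drained M c) ≤ (1 - q) * Real.exp (-(θ * M))
      * Real.exp (θ * c) + Real.exp (θ * M) := by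
    have h4 := mul_le_mul_of_nonneg_left hexp hp
    have h5 := mul_le_mul_of_nonneg_right hp1 (Real.exp_pos (θ * M)).le
    linarith
  have h6 := mul_le_mul_of_nonneg_left h3 hL.le
  linarith

/-- The Lyapunov function contracts for a small exponent when `1 < φ_inc`. -/
lemma exists_drift_exponent (hM : 0 < M) (hlam : 0 < lam) (hphi : 1 < phiInc M lam w Γ) :
    ∃ θ, 0 < θ ∧ θ < lam ∧
      lam / (lam - θ) * (expNeg w Γ + (1 - expNeg w Γ) * Real.exp (-(θ * M))) < 1 := by
  have hp := one_sub_expNeg_pos hM hlam hphi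
  set φ := phiInc M lam w Γ with hφ
  have hφ' : φ = M * lam * (1 - expNeg w Γ) := rfl
  -- The bound e^{-θM} ≤ 1/(1+θM) reduces the claim to 1 + θM < φ, hence the cap (φ-1)/M.
  obtain ⟨θ, hθ0, hθ⟩ := exists_between (lt_min hlam (div_pos (sub_pos.2 hphi) hM))
  obtain ⟨hθ1, hθ2⟩ := lt_min_iff.1 hθ
  rw [lt_div_iff₀ hM] at hθ2
  refine ⟨θ, hθ0, hθ1, ?_⟩
  have hexp : Real.exp (-(θ * M)) ≤ 1 / (1 + θ * M) := by
    rw [Real.exp_neg, ← one_div]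
    have := Real.add_one_le_exp (θ * M)
    have : 0 < θ * M := by positivity
    gcongr
    linarith
  have hpos : 0 < 1 + θ * M := by positivity
  have h1 : (1 - expNeg w Γ) * Real.exp (-(θ * M)) ≤ (1 - expNeg w Γ) * (1 / (1 + θ * M)) := by
    gcongr
  have h2 : lam * (expNeg w Γ + (1 - expNeg w Γ) * (1 / (1 + θ * M))) < lam - θ := by
    have h3 : lam * (expNeg w Γ + (1 - expNeg w Γ) * (1 / (1 + θ * M)))
        = lam - θ * φ / (1 + θ * M) := by
      rw [hφ']; field_simp; ring
    rw [h3]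
    have h4 : θ < θ * φ / (1 + θ * M) := by
      rw [lt_div_iff₀ hpos]
      have : 1 + θ * M < φ := by linarith
      gcongr
    linarith
  rw [div_mul_eq_mul_div, div_lt_one (by linarith)]
  have h5 := mul_le_mul_of_nonneg_left h1 hlam.le
  linarith

lemma stepMap_minorization (hM : 0 < M) (hlam : 0 < lam) (hp : 0 ≤ 1 - expNeg w Γ)
    (hκ : κ {z | Γ ≤ ENNReal.ofReal (linkSNR P σ z)} = ENNReal.ofReal (expNeg w Γ))
    {θ : ℝ} (hθ0 : 0 < θ) (R : ℝ) :
    ∃ η : Measure ℝ, η ≠ 0 ∧ ∀ b, lyapunov θ b ≤ R →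
      η ≤ ((expMeasure lam).prod κ).map fun e => stepMap M Γ P σ (b, e) := by
  -- The absolute value only keeps the threshold nonnegative: for R < 1 the sublevel set is empty.
  have hCnn : 0 ≤ |Real.log R| / θ := by positivity
  refine ⟨(expMeasure lam).restrict (Set.Ici (|Real.log R| / θ)),
    expMeasure_restrict_Ici_ne_zero hlam hCnn, fun b hb => ?_⟩
  have hb0 : 0 ≤ max b 0 := le_max_right _ _
  have hbC : max b 0 ≤ |Real.log R| / θ := by
    rw [le_div_iff₀ hθ0, mul_comm]
    exact ((Real.le_log_iff_exp_le ((Real.exp_pos _).trans_le hb)).2 hb).trans (le_abs_self _)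
  rw [map_stepMap hlam hκ]
  have h1 := restrict_Ici_expMeasure_le hlam hb0 hbC
  have h2 := restrict_Ici_expMeasure_le hlam (drained_nonneg (M := M) hb0)
    ((drained_le hM).trans hbC)
  refine Measure.le_iff'.2 fun A => ?_
  rw [Measure.add_apply, Measure.smul_apply, Measure.smul_apply]
  have hsum : ENNReal.ofReal (expNeg w Γ) + ENNReal.ofReal (1 - expNeg w Γ) = 1 := by
    rw [← ENNReal.ofReal_add (expNeg_nonneg w Γ) hp]
    simp
  calc _ = ENNReal.ofReal (expNeg w Γ) • (expMeasure lam).restrict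
        (Set.Ici (|Real.log R| / θ)) A + ENNReal.ofReal (1 - expNeg w Γ) •
          (expMeasure lam).restrict (Set.Ici (|Real.log R| / θ)) A := by
        rw [← add_smul, hsum, one_smul]
    _ ≤ _ := by
        gcongr

end Transition

/-! ### Stationarity -/

section Stationary

variable {M lam p Q : ℝ}

/-- The law with density `bufferDensity`. -/
noncomputable def bufferLaw (M lam p Q : ℝ) : Measure ℝ :=
  volume.withDensity fun x => ENNReal.ofReal (bufferDensity M lam p Q x)

lemma isProbabilityMeasure_bufferLaw (hM : 0 < M) (hlam : 0 < lam) (hp : 0 < p) (hQ : Q < 0)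
    (hkey : Q + lam * p = lam * p * Real.exp (Q * M)) :
    IsProbabilityMeasure (bufferLaw M lam p Q) := by
  obtain ⟨h1, h2⟩ := integrable_bufferDensity hM hlam hp hQ hkey
  constructor
  rw [bufferLaw, withDensity_apply _ MeasurableSet.univ, Measure.restrict_univ,
    ← ofReal_integral_eq_lintegral_ofReal h1
      (ae_of_all _ (bufferDensity_nonneg hM hlam hp hQ hkey)), h2, ENNReal.ofReal_one]

lemma ae_pos_bufferLaw (hM : 0 < M) (hlam : 0 < lam) (hp : 0 < p)
    (hkey : Q + lam * p = lam * p * Real.exp (Q * M)) : ∀ᵐ x ∂bufferLaw M lam p Q, 0 < x := by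
  rw [bufferLaw, ae_withDensity_iff
    (continuous_bufferDensity hM hlam hp hkey).measurable.ennreal_ofReal]
  refine ae_of_all _ fun x hx => ?_
  by_contra h
  exact hx (by rw [bufferDensity_of_nonpos hM (not_lt.1 h), ENNReal.ofReal_zero])

lemma bufferLaw_Iic (hM : 0 < M) (hlam : 0 < lam) (hp : 0 < p) (hQ : Q < 0)
    (hkey : Q + lam * p = lam * p * Real.exp (Q * M)) {x : ℝ} (hx : 0 ≤ x) :
    bufferLaw M lam p Q (Set.Iic x)
      = ENNReal.ofReal (∫ u in (0 : ℝ)..x, bufferDensity M lam p Q u) := by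
  obtain ⟨h1, -⟩ := integrable_bufferDensity hM hlam hp hQ hkey
  rw [bufferLaw, withDensity_apply _ measurableSet_Iic,
    ← ofReal_integral_eq_lintegral_ofReal h1.integrableOn
      (ae_of_all _ (bufferDensity_nonneg hM hlam hp hQ hkey)), intervalIntegral.integral_of_le hx]
  congr 1
  refine setIntegral_eq_of_subset_of_forall_sdiff_eq_zero measurableSet_Iic
    Set.Ioc_subset_Iic_self fun u hu => ?_
  refine bufferDensity_of_nonpos hM (not_lt.1 fun h => hu.2 ⟨h, hu.1⟩)

lemma bufferLaw_Iic_of_neg (hM : 0 < M) (hlam : 0 < lam) (hp : 0 < p)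
    (hkey : Q + lam * p = lam * p * Real.exp (Q * M)) {x : ℝ} (hx : x < 0) :
    bufferLaw M lam p Q (Set.Iic x) = 0 := by
  refine measure_mono_null (fun y hy => ?_) (ae_iff.1 (ae_pos_bufferLaw hM hlam hp hkey))
  exact not_lt.2 ((Set.mem_Iic.1 hy).trans hx.le)

/-- The left side is the probability that one step from the candidate law ends at or below x. Since
g and F vanish on (-∞, 0], it truncates to the three integrals of the stationarity equation. -/
lemma integral_cdf_mul_bufferDensity (hM : 0 < M) (hlam : 0 < lam) (hp : 0 < p) (hQ : Q < 0)
    (hkey : Q + lam * p = lam * p * Real.exp (Q * M)) {x : ℝ} (hx : 0 ≤ x) :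
    ∫ u, ((1 - p) * cdf (expMeasure lam) (x - u) + p * cdf (expMeasure lam) (x - drained M u))
        * bufferDensity M lam p Q u = ∫ u in (0 : ℝ)..x, bufferDensity M lam p Q u := by
  obtain ⟨hgi, -⟩ := integrable_bufferDensity hM hlam hp hQ hkey
  rw [← integral_bufferDensity_eq hM hlam hp hkey hx]
  set g := bufferDensity M lam p Q with hg
  set F := cdf (expMeasure lam) with hF
  have hFm : Measurable F := (monotone_cdf _).measurable
  have hF0 : ∀ y, y ≤ 0 → F y = 0 := fun y hy => by
    rw [hF, cdf_expMeasure_eq hlam]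
    split_ifs with h
    · obtain rfl := le_antisymm hy h
      simp
    · rfl
  have hbd : ∀ c : ℝ → ℝ, Measurable c → Integrable (fun u => F (x - c u) * g u) := by
    intro c hc
    refine hgi.bdd_mul (c := 1) (hFm.comp (measurable_const.sub hc)).aestronglyMeasurable
      (ae_of_all _ fun u => ?_)
    rw [Real.norm_eq_abs, abs_le]
    exact ⟨by linarith [cdf_nonneg (expMeasure lam) (x - c u)], cdf_le_one _ _⟩
  have h1 := hbd id measurable_id
  have h2 := hbd (drained M) (measurable_drained M)
  simp only [id_eq] at h1
  have hsplit : ∀ u, ((1 - p) * F (x - u) + p * F (x - drained M u)) * g u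
      = (1 - p) * (F (x - u) * g u) + p * (F (x - drained M u) * g u) := fun u => by ring
  simp_rw [hsplit]
  rw [integral_add (h1.const_mul _) (h2.const_mul _), integral_const_mul, integral_const_mul]
  have hg0 : ∀ u, u ≤ 0 → g u = 0 := fun u hu => bufferDensity_of_nonpos hM hu
  have e1 : ∫ u, F (x - u) * g u = ∫ u in (0 : ℝ)..x, F (x - u) * g u := by
    rw [intervalIntegral.integral_of_le hx]
    refine (setIntegral_eq_integral_of_forall_compl_eq_zero fun u hu => ?_).symm
    obtain h | h := le_or_gt u 0
    · rw [hg0 u h, mul_zero]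
    · rw [hF0 _ (by have := fun h' => hu ⟨h, h'⟩; linarith [not_le.1 this]), zero_mul]
  have e2 : ∫ u in Set.Iio M, F (x - drained M u) * g u
      = ∫ u in (0 : ℝ)..(min x M), F (x - u) * g u := by
    rw [intervalIntegral.integral_of_le (le_min hx hM.le), setIntegral_congr_fun (g := fun u => F (x - u) * g u)
      measurableSet_Iio (fun u hu => by simp only [drained, if_neg (not_le.2 (Set.mem_Iio.1 hu))]),
      ← integral_Iic_eq_integral_Iio]
    refine setIntegral_eq_of_subset_of_forall_sdiff_eq_zero measurableSet_Iic
      (fun u hu => hu.2.trans (min_le_right _ _)) fun u hu => ?_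
    obtain h | h := le_or_gt u 0
    · rw [hg0 u h, mul_zero]
    · have : x < u := by
        by_contra h'
        exact hu.2 ⟨h, le_min (not_lt.1 h') hu.1⟩
      rw [hF0 _ (by linarith), zero_mul]
  have e3 : ∫ u in (Set.Iio M)ᶜ, F (x - drained M u) * g u
      = ∫ u in M..(M + x), F (x - u + M) * g u := by
    rw [intervalIntegral.integral_of_le (by linarith), Set.compl_Iio,
      setIntegral_congr_fun (g := fun u => F (x - u + M) * g u)
      measurableSet_Ici (fun u hu => by
        simp only [drained, if_pos (Set.mem_Ici.1 hu)]; congr 2; ring), integral_Ici_eq_integral_Ioi]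
    refine setIntegral_eq_of_subset_of_forall_sdiff_eq_zero measurableSet_Ioi
      (fun u hu => hu.1) fun u hu => ?_
    have : M + x < u := by
      by_contra h'
      exact hu.2 ⟨hu.1, not_lt.1 h'⟩
    rw [hF0 _ (by linarith), zero_mul]
  rw [e1, ← integral_add_compl (measurableSet_Iio (a := M)) h2, e2, e3]
  ring

variable {P σ w : ℝ} {Γ : ℝ≥0∞} {κ : Measure ℂ} [IsProbabilityMeasure κ]

lemma map_stepMap_bufferLaw (hM : 0 < M) (hlam : 0 < lam) (hp : 0 < 1 - expNeg w Γ) (hQ : Q < 0)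
    (hkey : Q + lam * (1 - expNeg w Γ) = lam * (1 - expNeg w Γ) * Real.exp (Q * M))
    (hκ : κ {z | Γ ≤ ENNReal.ofReal (linkSNR P σ z)} = ENNReal.ofReal (expNeg w Γ)) :
    ((bufferLaw M lam (1 - expNeg w Γ) Q).prod ((expMeasure lam).prod κ)).map (stepMap M Γ P σ)
      = bufferLaw M lam (1 - expNeg w Γ) Q := by
  have := isProbabilityMeasure_expMeasure hlam
  have := isProbabilityMeasure_bufferLaw hM hlam hp hQ hkey
  have hstep := measurable_stepMap M Γ P σ
  have := Measure.isProbabilityMeasure_map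
    (μ := (bufferLaw M lam (1 - expNeg w Γ) Q).prod ((expMeasure lam).prod κ)) hstep.aemeasurable
  refine Measure.ext_of_Iic _ _ fun x => ?_
  have hq := expNeg_nonneg w Γ
  have hkern : ∀ u, 0 < u → ((expMeasure lam).prod κ) (Prod.mk u ⁻¹' (stepMap M Γ P σ ⁻¹' Set.Iic x))
      = ENNReal.ofReal ((1 - (1 - expNeg w Γ)) * cdf (expMeasure lam) (x - u)
        + (1 - expNeg w Γ) * cdf (expMeasure lam) (x - drained M u)) := by
    intro u hu
    have h1 := congrArg (fun m : Measure ℝ => m (Set.Iic x)) (map_stepMap (M := M) hlam hκ u)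
    have hpre : ∀ c : ℝ, (expMeasure lam).map (fun y => c + y) (Set.Iic x)
        = ENNReal.ofReal (cdf (expMeasure lam) (x - c)) := by
      intro c
      rw [Measure.map_apply (by fun_prop) measurableSet_Iic, cdf_eq_real, ofReal_measureReal]
      congr 1
      ext y
      simp only [Set.mem_preimage, Set.mem_Iic]
      constructor <;> intro h <;> linarith
    have hsu : Measurable fun e => stepMap M Γ P σ (u, e) := hstep.comp measurable_prodMk_left
    rw [Measure.map_apply hsu measurableSet_Iic, Measure.add_apply,
      Measure.smul_apply, Measure.smul_apply, hpre, hpre, max_eq_left hu.le, smul_eq_mul,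
      smul_eq_mul, ← ENNReal.ofReal_mul hq, ← ENNReal.ofReal_mul hp.le, ← ENNReal.ofReal_add
        (mul_nonneg hq (cdf_nonneg _ _)) (mul_nonneg hp.le (cdf_nonneg _ _))] at h1
    rw [sub_sub_cancel]
    exact h1
  have hae : ∀ᵐ u ∂bufferLaw M lam (1 - expNeg w Γ) Q,
      ((expMeasure lam).prod κ) (Prod.mk u ⁻¹' (stepMap M Γ P σ ⁻¹' Set.Iic x))
      = ENNReal.ofReal ((1 - (1 - expNeg w Γ)) * cdf (expMeasure lam) (x - u)
        + (1 - expNeg w Γ) * cdf (expMeasure lam) (x - drained M u)) := by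
    filter_upwards [ae_pos_bufferLaw hM hlam hp hkey] with u hu using hkern u hu
  rw [Measure.map_apply hstep measurableSet_Iic, Measure.prod_apply (hstep measurableSet_Iic),
    lintegral_congr_ae hae]
  obtain hx | hx := lt_or_ge x 0
  · rw [bufferLaw_Iic_of_neg hM hlam hp hkey hx, lintegral_eq_zero_iff' ?_]
    · filter_upwards [ae_pos_bufferLaw hM hlam hp hkey] with u hu
      have := drained_nonneg (M := M) hu.le
      rw [cdf_expMeasure_eq hlam, cdf_expMeasure_eq hlam, if_neg (by linarith),
        if_neg (by linarith)]
      simp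
    · have hFm : Measurable (cdf (expMeasure lam)) := (monotone_cdf _).measurable
      have := measurable_drained M
      exact Measurable.aemeasurable (by fun_prop)
  · have hFm : Measurable (cdf (expMeasure lam)) := (monotone_cdf _).measurable
    have hdm := measurable_drained M
    have hgm := (continuous_bufferDensity hM hlam hp hkey).measurable
    obtain ⟨hgi, -⟩ := integrable_bufferDensity hM hlam hp hQ hkey
    have hg0 := bufferDensity_nonneg hM hlam hp hQ hkey
    have hc0 : ∀ u, 0 ≤ (1 - (1 - expNeg w Γ)) * cdf (expMeasure lam) (x - u)
        + (1 - expNeg w Γ) * cdf (expMeasure lam) (x - drained M u) := fun u => by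
      have := cdf_nonneg (expMeasure lam) (x - u)
      have := cdf_nonneg (expMeasure lam) (x - drained M u)
      rw [sub_sub_cancel]
      positivity
    rw [bufferLaw_Iic hM hlam hp hQ hkey hx, ← integral_cdf_mul_bufferDensity hM hlam hp hQ hkey hx,
      bufferLaw, lintegral_withDensity_eq_lintegral_mul _ hgm.ennreal_ofReal (by fun_prop),
      ofReal_integral_eq_lintegral_ofReal]
    · refine lintegral_congr fun u => ?_
      rw [Pi.mul_apply, ← ENNReal.ofReal_mul (hg0 u), mul_comm]
    · refine hgi.bdd_mul (c := 1) (Measurable.aestronglyMeasurable (by fun_prop))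
        (ae_of_all _ fun u => ?_)
      rw [Real.norm_eq_abs, abs_of_nonneg (hc0 u), sub_sub_cancel]
      have h1 := mul_le_mul_of_nonneg_left (cdf_le_one (expMeasure lam) (x - u)) hq
      have h2 := mul_le_mul_of_nonneg_left (cdf_le_one (expMeasure lam) (x - drained M u)) hp.le
      linarith
    · exact ae_of_all _ fun u => mul_nonneg (hc0 u) (hg0 u)

end Stationary

/-! ### The buffer is a Markov chain -/

section Markov

variable {Ω : Type*} [MeasurableSpace Ω] {μ : Measure Ω}

/-- Disjoint index blocks generate independent σ-algebras; measurable modifications are used so that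
these are sub-σ-algebras of the ambient one. -/
lemma indepFun_tail_of_iIndepFun {β : Type*} [MeasurableSpace β] {ξ : ℕ → Ω → β}
    (hm : ∀ i, AEMeasurable (ξ i) μ) (h : iIndepFun ξ μ) (n : ℕ) :
    IndepFun (ξ n) (fun ω i => ξ (n + 1 + i) ω) μ := by
  have h' : iIndepFun (fun i => (hm i).mk (ξ i)) μ := h.congr fun i => (hm i).ae_eq_mk
  have hmk : ∀ i, Measurable ((hm i).mk (ξ i)) := fun i => (hm i).measurable_mk
  have key : IndepFun ((hm n).mk (ξ n)) (fun ω i => (hm (n + 1 + i)).mk (ξ (n + 1 + i)) ω) μ := by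
    have hdisj : Disjoint ({n} : Set ℕ) (Set.Ioi n) := by simp
    have h1 := indep_iSup_of_disjoint (fun i => (hmk i).comap_le)
      ((iIndepFun_iff_iIndep _ _ _).1 h') hdisj
    rw [IndepFun_iff_Indep]
    refine indep_of_indep_of_le_right (indep_of_indep_of_le_left h1 ?_) ?_
    · simp
    · rw [MeasurableSpace.pi, MeasurableSpace.comap_iSup]
      refine iSup_le fun i => ?_
      rw [MeasurableSpace.comap_comp]
      exact le_iSup₂_of_le (n + 1 + i) (Set.mem_Ioi.2 (by omega)) le_rfl
  refine key.congr (hm n).ae_eq_mk.symm ?_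
  have hall : ∀ᵐ ω ∂μ, ∀ i, ξ (n + 1 + i) ω = (hm (n + 1 + i)).mk (ξ (n + 1 + i)) ω :=
    ae_all_iff.2 fun i => (hm _).ae_eq_mk
  filter_upwards [hall] with ω hω
  funext i
  exact (hω i).symm

variable [IsProbabilityMeasure μ]

/-- Both hypotheses together say that the joint law is a triple product, which may be reassociated.
-/
lemma indepFun_prodMk_of_indepFun {β₁ β₂ β₃ : Type*} [MeasurableSpace β₁] [MeasurableSpace β₂]
    [MeasurableSpace β₃] {f : Ω → β₁} {g : Ω → β₂} {k : Ω → β₃} (hf : AEMeasurable f μ)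
    (hg : AEMeasurable g μ) (hk : AEMeasurable k μ) (h : IndepFun f (fun ω => (g ω, k ω)) μ)
    (hgk : IndepFun g k μ) : IndepFun (fun ω => (f ω, g ω)) k μ := by
  have := Measure.isProbabilityMeasure_map hf
  have := Measure.isProbabilityMeasure_map hg
  have := Measure.isProbabilityMeasure_map hk
  have hfg : IndepFun f g μ := h.comp measurable_id measurable_fst
  have h1 := (indepFun_iff_map_prod_eq_prod_map_map hf (hg.prodMk hk)).1 h
  have h2 := (indepFun_iff_map_prod_eq_prod_map_map hg hk).1 hgk
  have h3 := (indepFun_iff_map_prod_eq_prod_map_map hf hg).1 hfg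
  rw [indepFun_iff_map_prod_eq_prod_map_map (hf.prodMk hg) hk, h3]
  rw [h2, ← Measure.prodAssoc_prod] at h1
  have h4 := congrArg (Measure.map MeasurableEquiv.prodAssoc.symm) h1
  rw [Measure.map_map MeasurableEquiv.prodAssoc.symm.measurable
      MeasurableEquiv.prodAssoc.measurable, MeasurableEquiv.symm_comp_self, Measure.map_id,
    AEMeasurable.map_map_of_aemeasurable MeasurableEquiv.prodAssoc.symm.measurable.aemeasurable
      (hf.prodMk (hg.prodMk hk))] at h4
  exact h4

/-- A chain driven by an independent sequence is independent of the future of that sequence. -/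
lemma aemeasurable_and_indepFun_of_recursion {S E : Type*} [MeasurableSpace S] [MeasurableSpace E]
    {g : S × E → S} (hg : Measurable g) {ξ : ℕ → Ω → E} {B : ℕ → Ω → S}
    (hξ : ∀ i, AEMeasurable (ξ i) μ) (hindep : iIndepFun ξ μ) (hB0 : AEMeasurable (B 0) μ)
    (hB0_indep : IndepFun (B 0) (fun ω i => ξ i ω) μ)
    (hB : ∀ i, B (i + 1) =ᵐ[μ] fun ω => g (B i ω, ξ i ω)) (n : ℕ) :
    AEMeasurable (B n) μ ∧ IndepFun (B n) (fun ω i => ξ (n + i) ω) μ := by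
  induction n with
  | zero => simpa using ⟨hB0, hB0_indep⟩
  | succ n ih =>
    obtain ⟨hm, hi⟩ := ih
    have htail : AEMeasurable (fun ω i => ξ (n + 1 + i) ω) μ :=
      aemeasurable_pi_iff.2 fun i => hξ _
    refine ⟨(hg.comp_aemeasurable (hm.prodMk (hξ n))).congr (hB n).symm, ?_⟩
    have hcons : Measurable fun s : ℕ → E => (s 0, fun i => s (i + 1)) := by fun_prop
    have h1 : IndepFun (B n) (fun ω => (ξ n ω, fun i => ξ (n + 1 + i) ω)) μ := by
      have h2 := hi.comp measurable_id hcons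
      convert! h2 using 1
      funext ω
      simp only [Function.comp_apply, add_zero, Prod.mk.injEq, true_and]
      funext i
      congr 1
      ring
    have h3 := indepFun_prodMk_of_indepFun hm (hξ n) htail h1
      (indepFun_tail_of_iIndepFun hξ hindep n)
    exact (h3.comp hg measurable_id).congr (hB n).symm (ae_eq_refl _)

lemma map_succ_of_recursion {S E : Type*} [MeasurableSpace S] [MeasurableSpace E]
    {g : S × E → S} (hg : Measurable g) {ξ : ℕ → Ω → E} {B : ℕ → Ω → S} {ρ : Measure E}
    (hξ : ∀ i, HasLaw (ξ i) ρ μ) (hindep : iIndepFun ξ μ) (hB0 : AEMeasurable (B 0) μ)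
    (hB0_indep : IndepFun (B 0) (fun ω i => ξ i ω) μ)
    (hB : ∀ i, B (i + 1) =ᵐ[μ] fun ω => g (B i ω, ξ i ω)) (n : ℕ) :
    μ.map (B (n + 1)) = ((μ.map (B n)).prod ρ).map g := by
  obtain ⟨hm, hi⟩ := aemeasurable_and_indepFun_of_recursion hg (fun i => (hξ i).aemeasurable)
    hindep hB0 hB0_indep hB n
  have h1 : IndepFun (B n) (ξ n) μ := hi.comp measurable_id (measurable_pi_apply 0)
  rw [Measure.map_congr (hB n), ← (hξ n).map_eq,
    ← (indepFun_iff_map_prod_eq_prod_map_map hm (hξ n).aemeasurable).1 h1,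
    AEMeasurable.map_map_of_aemeasurable hg.aemeasurable (hm.prodMk (hξ n).aemeasurable)]
  rfl

end Markov

lemma bufferStep_nonneg {M b x γ : ℝ} {Γ : ℝ≥0∞} (hb : 0 ≤ b) (hx : 0 ≤ x) :
    0 ≤ bufferStep M Γ b x γ := by
  unfold bufferStep
  split_ifs <;> linarith

end IOFP

theorem theorem4 {Ω : Type*} [MeasurableSpace Ω] (μ : Measure Ω) [IsProbabilityMeasure μ]
    (M lam P σ d α : ℝ) (Γ : ℝ≥0∞)
    (hM : 0 < M) (hlam : 0 < lam) (hP : 0 < P) (hσ : 0 < σ) (hd : 0 < d)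
    (X : ℕ → Ω → ℝ) (h : ℕ → Ω → ℂ) (B : ℕ → Ω → ℝ)
    (hX : ∀ i, HasLaw (X i) (expMeasure lam) μ)
    (hh : ∀ i, HasLaw (h i) (IOFP.complexGaussian (Real.toNNReal (d ^ (-α)))) μ)
    (hXh : ∀ i, IndepFun (X i) (h i) μ)
    (hindep : iIndepFun (fun i ω => (X i ω, h i ω)) μ)
    (hB0 : AEMeasurable (B 0) μ) (hB0_nonneg : ∀ᵐ ω ∂μ, 0 ≤ B 0 ω)
    (hB0_indep : IndepFun (B 0) (fun ω i => (X i ω, h i ω)) μ)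
    (hB : ∀ i ω, B (i + 1) ω
      = IOFP.bufferStep M Γ (B i ω) (X i ω) (IOFP.linkSNR P σ (h i ω)))
    (hphi : 1 < IOFP.phiInc M lam (IOFP.W2 P σ d α) Γ) :
    IOFP.Q M lam (IOFP.W2 P σ d α) Γ < 0 ∧
    ∃ ν : Measure ℝ, ∃ _ : IsProbabilityMeasure ν,
      TendstoInDistribution B atTop (id : ℝ → ℝ) (fun _ => μ) ν ∧
      IOFP.IntegralEquation M (IOFP.W2 P σ d α) Γ (cdf (expMeasure lam)) (cdf ν)
        (IOFP.limitPDF M lam (IOFP.W2 P σ d α) Γ) ∧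
      ν = volume.withDensity
        (fun x => ENNReal.ofReal (IOFP.limitPDF M lam (IOFP.W2 P σ d α) Γ x)) := by
  obtain ⟨hQ, hkey⟩ := IOFP.Q_spec hM hphi
  have hp := IOFP.one_sub_expNeg_pos hM hlam hphi
  have hκ := IOFP.complexGaussian_le_linkSNR (α := α) hP hσ hd Γ
  set w := IOFP.W2 P σ d α
  set κ := IOFP.complexGaussian (Real.toNNReal (d ^ (-α)))
  set ν := IOFP.bufferLaw M lam (1 - IOFP.expNeg w Γ) (IOFP.Q M lam w Γ)
  have hνprob : IsProbabilityMeasure ν :=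
    IOFP.isProbabilityMeasure_bufferLaw hM hlam hp hQ hkey
  have := isProbabilityMeasure_expMeasure hlam
  have hpdf : IOFP.limitPDF M lam w Γ
      = IOFP.bufferDensity M lam (1 - IOFP.expNeg w Γ) (IOFP.Q M lam w Γ) := rfl
  refine ⟨hQ, ν, hνprob, ?_, ?_, rfl⟩
  · have hξ : ∀ i, HasLaw (fun ω => (X i ω, h i ω)) ((expMeasure lam).prod κ) μ := fun i =>
      ⟨(hX i).aemeasurable.prodMk (hh i).aemeasurable, by
        rw [(indepFun_iff_map_prod_eq_prod_map_map (hX i).aemeasurable (hh i).aemeasurable).1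
          (hXh i), (hX i).map_eq, (hh i).map_eq]⟩
    have hXnn : ∀ i, ∀ᵐ ω ∂μ, 0 ≤ X i ω := fun i =>
      ae_of_ae_map (hX i).aemeasurable
        (by rw [(hX i).map_eq]; exact IOFP.ae_nonneg_expMeasure lam)
    have hBnn : ∀ n, ∀ᵐ ω ∂μ, 0 ≤ B n ω := by
      intro n
      induction n with
      | zero => exact hB0_nonneg
      | succ n ih =>
        filter_upwards [ih, hXnn n] with ω h1 h2
        rw [hB]
        exact IOFP.bufferStep_nonneg h1 h2
    -- The clamp in `stepMap`, which lets drift and minorization hold on all of ℝ, is almost surely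
    -- inactive along the buffer.
    have hrec : ∀ i, B (i + 1) =ᵐ[μ]
        fun ω => IOFP.stepMap M Γ P σ (B i ω, X i ω, h i ω) := by
      intro i
      filter_upwards [hBnn i] with ω hω
      rw [hB, IOFP.stepMap, max_eq_left hω]
    have hstep := IOFP.measurable_stepMap M Γ P σ
    have hBm : ∀ n, AEMeasurable (B n) μ := fun n =>
      (IOFP.aemeasurable_and_indepFun_of_recursion hstep (fun i => (hξ i).aemeasurable) hindep
        hB0 hB0_indep hrec n).1
    refine ⟨hBm, aemeasurable_id, ?_⟩
    refine ProbabilityMeasure.tendsto_iff_forall_integral_tendsto.2 fun f => ?_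
    change Tendsto (fun n => ∫ s, f s ∂(μ.map (B n))) atTop (𝓝 (∫ s, f s ∂(ν.map id)))
    rw [Measure.map_id]
    obtain ⟨θ, hθ0, hθ1, hγ⟩ := IOFP.exists_drift_exponent hM hlam hphi
    have hL : 0 < lam / (lam - θ) := div_pos hlam (by linarith)
    have hdrift := IOFP.lyapunov_drift (M := M) hlam hp.le hκ hθ0.le hθ1
    have hq := IOFP.expNeg_nonneg w Γ
    exact IOFP.tendsto_integral_of_drift_of_minorization hstep
      (V := IOFP.lyapunov θ) (fun b => (Real.exp_pos _).le) (fun b => (hdrift b).1)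
      (by positivity) hγ (by positivity) (fun b => (hdrift b).2)
      (IOFP.stepMap_minorization hM hlam hp.le hκ hθ0)
      (m := fun n => μ.map (B n)) (fun n => Measure.isProbabilityMeasure_map (hBm n))
      (IOFP.map_succ_of_recursion hstep hξ hindep hB0 hB0_indep hrec)
      (IOFP.map_stepMap_bufferLaw hM hlam hp hQ hkey hκ)
      f.continuous.measurable (fun s => f.norm_coe_le_norm s)
  · have hcdf : ∀ x, 0 ≤ x → cdf ν x
        = ∫ u in (0 : ℝ)..x, IOFP.limitPDF M lam w Γ u := fun x hx => by
      rw [cdf_eq_real, measureReal_def, IOFP.bufferLaw_Iic hM hlam hp hQ hkey hx,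
        ENNReal.toReal_ofReal (intervalIntegral.integral_nonneg hx fun u _ =>
          IOFP.bufferDensity_nonneg hM hlam hp hQ hkey u), hpdf]
    constructor
    · intro x hx hxM
      have := IOFP.integral_bufferDensity_eq hM hlam hp hkey hx
      rw [min_eq_left hxM.le, sub_sub_cancel, ← hpdf] at this
      rw [hcdf x hx, this]
    · intro x hx
      have := IOFP.integral_bufferDensity_eq hM hlam hp hkey (hM.le.trans hx)
      rw [min_eq_right hx, sub_sub_cancel, ← hpdf] at this
      rw [hcdf x (hM.le.trans hx), this]
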